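/- A \emph{GF(2)-grammar} $G$ over an alphabet $\Sigma$ is, syntactically, an ordinary context-free grammar (with a finite set of rules and initial symbol $S$) such that every string $w\in\Sigma^*$ has only finitely many parse trees with root $S$; the language described by $G$ is the set of all $w\in\Sigma^*$ for which the number of these parse trees is odd. A language is \emph{inherently ambiguous} if it is context-free and every context-free grammar generating it is ambiguous, that is, assigns at least two parse trees with root the initial symbol to some string. Let $a,b,c$ be three distinct letters of an alphabet $\Sigma$. Then the language $$\{a^n b^m c^\ell \mid n,m,\ell\ge 0,\ n=m \text{ or } m=\ell\}$$ is not described by any GF(2)-grammar over $\Sigma$, and it is inherently ambiguous. -/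

import Mathlib

/-- A parse tree of an ordinary (context-free) grammar `g` whose root is labelled by the given
symbol. A terminal symbol labels only leaves. A node labelled by a nonterminal comes with a rule
`r` of the grammar for that nonterminal, and has one ordered child for each symbol occurrence of
the right-hand side of `r` (no children if the right-hand side is empty). -/
inductive ContextFreeGrammar.ParseTree {T : Type*} (g : ContextFreeGrammar T) :
    Symbol T g.NT → Type _
  | leaf (t : T) : ContextFreeGrammar.ParseTree g (Symbol.terminal t)
  | node (r : ContextFreeRule T g.NT) (hr : r ∈ g.rules)
      (children : ∀ i : Fin r.output.length, ContextFreeGrammar.ParseTree g (r.output.get i)) :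
      ContextFreeGrammar.ParseTree g (Symbol.nonterminal r.input)

/-- The string read off the leaves of a parse tree from left to right. -/
def ContextFreeGrammar.ParseTree.yield {T : Type*} {g : ContextFreeGrammar T} :
    {X : Symbol T g.NT} → g.ParseTree X → List T
  | _, .leaf t => [t]
  | _, .node _ _ children => (List.ofFn fun i => (children i).yield).flatten

/-- The set of parse trees of the string `w` as the nonterminal `A`. -/
def ContextFreeGrammar.parseTrees {T : Type*} (g : ContextFreeGrammar T) (A : g.NT) (w : List T) :
    Set (g.ParseTree (Symbol.nonterminal A)) :=
  {t | t.yield = w}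

/-- A grammar is unambiguous if every string has at most one parse tree as the initial symbol. -/
def ContextFreeGrammar.IsUnambiguous {T : Type*} (g : ContextFreeGrammar T) : Prop :=
  ∀ w : List T, (g.parseTrees g.initial w).Subsingleton

/-- A language is inherently ambiguous if it is context-free and every context-free grammar
that generates it is ambiguous. -/
def Language.IsInherentlyAmbiguous {T : Type*} (L : Language T) : Prop :=
  L.IsContextFree ∧ ∀ g : ContextFreeGrammar T, g.language = L → ¬ g.IsUnambiguous

/-- A GF(2)-grammar: syntactically an ordinary grammar (a finite set of rules
`A → X₁ ⊙ ⋯ ⊙ X_ℓ`), subject to the well-formedness condition that every string has only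
finitely many parse trees in the corresponding ordinary grammar. -/
structure GF2Grammar (T : Type*) extends ContextFreeGrammar T where
  /-- Every string has finitely many parse trees (as the initial symbol). -/
  wellFormed : ∀ w : List T, (toContextFreeGrammar.parseTrees initial w).Finite

/-- The language described by a GF(2)-grammar: the strings with an odd number of parse trees
as the initial symbol. -/
def GF2Grammar.language {T : Type*} (G : GF2Grammar T) : Language T :=
  {w : List T | Odd (G.toContextFreeGrammar.parseTrees G.initial w).ncard}

/-- The language `{aⁿ bᵐ cˡ | n = m or m = l}`, with `n, m, l ≥ 0`. -/
def someEqualLanguage {T : Type*} (a b c : T) : Language T :=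
  {w : List T | ∃ n m l : ℕ, (n = m ∨ m = l) ∧
    w = List.replicate n a ++ List.replicate m b ++ List.replicate l c}

/-!
Sum the products of the transition matrices of an automaton for the sorted words `x₀^m₀ ⋯ x_k^m_k`
over all parse trees. The rules of the grammar become a polynomial system for upper triangular
matrices of power series, and the sum of the first row of the solution counts the trees of each
sorted word. Finiteness of the tree sets forces the Jacobian determinant `det (1 - J)` of the system
to be nonzero, also when its noncommutative partial derivatives are evaluated at two different
diagonal entries.

A diagonal entry involves a single variable. It solves a polynomial system with nonzero Jacobian
determinant, so derivations vanish on it by Cramer's rule, and it is algebraic. An entry above the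
diagonal solves a linear system whose determinant involves two diagonal entries only. By induction,
a product of nonzero polynomials in two variables each multiplies every entry into the algebra
generated by the algebraic series in one variable.

For the present language the count is odd at `x₀^n x₁^m x₂^l` exactly if `n = m` or `m = l`, so
modulo 2 the diagonal series `1 / (1 - x₀ x₁ x₂)` would have this form too, that is,
`p = (1 - x₀ x₁ x₂) f`, where `p` is a product of polynomials in two variables and `f` is a
combination of products of univariate series. The coefficients of the powers of one variable in
`f` span a finite-dimensional space, and this makes `f` a polynomial. But then the irreducible
polynomial `1 - x₀ x₁ x₂` divides a factor of `p`, although that factor lacks a variable.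
-/

namespace TreeSeries

open ContextFreeGrammar

/-! ### Parse trees and languages -/

section Trees

variable {T : Type*} {g : ContextFreeGrammar T}

/-- A family of parse trees, one for each symbol of a sentential form. -/
abbrev Forest (g : ContextFreeGrammar T) (α : List (Symbol T g.NT)) : Type _ :=
  ∀ i : Fin α.length, g.ParseTree (α.get i)

/-- The string read off the leaves of a forest from left to right. -/
def Forest.yield {α : List (Symbol T g.NT)} (f : Forest g α) : List T :=
  (List.ofFn fun i => (f i).yield).flatten

/-- Separating the first tree of a forest from the others. -/
def Forest.consEquiv (X : Symbol T g.NT) (α : List (Symbol T g.NT)) :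
    g.ParseTree X × Forest g α ≃ Forest g (X :: α) :=
  Fin.consEquiv fun i : Fin (α.length + 1) => g.ParseTree ((X :: α).get i)

lemma Forest.yield_consEquiv {X : Symbol T g.NT} {α : List (Symbol T g.NT)}
    (p : g.ParseTree X × Forest g α) :
    (consEquiv X α p).yield = p.1.yield ++ p.2.yield := by
  simp only [Forest.yield]
  exact (congrArg List.flatten (List.ofFn_succ (n := α.length))).trans (List.flatten_cons ..)

instance : Unique (Forest g []) := Pi.uniqueOfIsEmpty fun i : Fin 0 => g.ParseTree ([].get i)

instance (t : T) : Unique (g.ParseTree (.terminal t)) where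
  default := .leaf t
  uniq x := by cases x; rfl

@[simp]
lemma yield_leaf (t : T) : (ParseTree.leaf t : g.ParseTree (.terminal t)).yield = [t] := by
  rw [ParseTree.yield]

lemma yield_node (r : ContextFreeRule T g.NT) (hr : r ∈ g.rules) (f : Forest g r.output) :
    (ParseTree.node r hr f).yield = f.yield := by
  rfl

/-- Separating the rule at the root of a parse tree from the forest below it. -/
def nodeEquiv (A : g.NT) :
    (Σ r : {r : ContextFreeRule T g.NT // r ∈ g.rules ∧ r.input = A}, Forest g r.1.output) ≃
      g.ParseTree (.nonterminal A) where
  toFun x := x.1.2.2 ▸ ParseTree.node x.1.1 x.1.2.1 x.2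
  invFun
    | .node r hr f => ⟨⟨r, hr, rfl⟩, f⟩
  left_inv := by
    rintro ⟨⟨r, hr, rfl⟩, f⟩
    rfl
  right_inv t := by
    cases t
    rfl

lemma yield_nodeEquiv (A : g.NT)
    (x : Σ r : {r : ContextFreeRule T g.NT // r ∈ g.rules ∧ r.input = A}, Forest g r.1.output) :
    (nodeEquiv A x).yield = x.2.yield := by
  obtain ⟨⟨r, hr, rfl⟩, f⟩ := x
  exact yield_node r hr f

/-- The strings that have a parse tree with a given root. -/
def yieldLanguage (g : ContextFreeGrammar T) (X : Symbol T g.NT) : Language T :=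
  Set.range (ParseTree.yield (X := X))

lemma mem_yieldLanguage {X : Symbol T g.NT} {w : List T} :
    w ∈ yieldLanguage g X ↔ ∃ t : g.ParseTree X, t.yield = w := Iff.rfl

lemma singleton_mem_yieldLanguage (g : ContextFreeGrammar T) (t : T) :
    [t] ∈ yieldLanguage g (.terminal t) :=
  ⟨.leaf t, yield_leaf t⟩

lemma Forest.yield_mem_prod {L : Symbol T g.NT → Language T} {α : List (Symbol T g.NT)}
    (f : Forest g α) (h : ∀ i, (f i).yield ∈ L (α.get i)) : f.yield ∈ (α.map L).prod := by
  induction α with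
  | nil => exact Language.nil_mem_one
  | cons X α ih =>
    obtain ⟨p, rfl⟩ := (consEquiv X α).surjective f
    rw [yield_consEquiv, List.map_cons, List.prod_cons]
    exact Language.append_mem_mul (h 0) (ih p.2 fun i => h i.succ)

lemma exists_forest_of_mem_prod {α : List (Symbol T g.NT)} {w : List T}
    (hw : w ∈ (α.map (yieldLanguage g)).prod) : ∃ f : Forest g α, f.yield = w := by
  induction α generalizing w with
  | nil => exact ⟨default, (Language.mem_one w).1 hw |>.symm⟩
  | cons X α ih =>
    rw [List.map_cons, List.prod_cons] at hw
    obtain ⟨_, ⟨t, rfl⟩, v, hv, rfl⟩ := Language.mem_mul.1 hw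
    obtain ⟨f, rfl⟩ := ih hv
    exact ⟨Forest.consEquiv X α (t, f), Forest.yield_consEquiv _⟩

lemma prod_yieldLanguage_le {r : ContextFreeRule T g.NT} (hr : r ∈ g.rules) :
    (r.output.map (yieldLanguage g)).prod ≤ yieldLanguage g (.nonterminal r.input) := by
  intro w hw
  obtain ⟨f, rfl⟩ := exists_forest_of_mem_prod hw
  exact ⟨.node r hr f, yield_node r hr f⟩

lemma yieldLanguage_le {L : Symbol T g.NT → Language T} (hleaf : ∀ t, [t] ∈ L (.terminal t))
    (hrule : ∀ r ∈ g.rules, (r.output.map L).prod ≤ L (.nonterminal r.input))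
    (X : Symbol T g.NT) : yieldLanguage g X ≤ L X := by
  rintro _ ⟨t, rfl⟩
  induction t with
  | leaf t => exact (yield_leaf t).symm ▸ hleaf t
  | node r hr f ih => exact hrule r hr (Forest.yield_mem_prod f ih)

lemma prod_le_prod_of_derives {L : Symbol T g.NT → Language T}
    (hrule : ∀ r ∈ g.rules, (r.output.map L).prod ≤ L (.nonterminal r.input))
    {α β : List (Symbol T g.NT)} (h : g.Derives α β) : (β.map L).prod ≤ (α.map L).prod := by
  induction h with
  | refl => rfl
  | tail _ h ih =>
    obtain ⟨r, hr, h⟩ := h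
    obtain ⟨p, q, rfl, rfl⟩ := h.exists_parts
    refine le_trans ?_ ih
    simp only [List.map_append, List.prod_append, List.map_singleton, List.prod_singleton]
    exact mul_le_mul' (mul_le_mul' le_rfl (hrule r hr)) le_rfl

/-- The strings derived from a given symbol. -/
def derivedLanguage (g : ContextFreeGrammar T) (X : Symbol T g.NT) : Language T :=
  {w | g.Derives [X] (w.map .terminal)}

lemma derives_of_mem_prod {α : List (Symbol T g.NT)} {w : List T}
    (hw : w ∈ (α.map (derivedLanguage g)).prod) : g.Derives α (w.map .terminal) := by
  induction α generalizing w with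
  | nil =>
    obtain rfl := (Language.mem_one w).1 hw
    exact .refl _
  | cons X α ih =>
    rw [List.map_cons, List.prod_cons] at hw
    obtain ⟨u, hu, v, hv, rfl⟩ := Language.mem_mul.1 hw
    rw [List.map_append]
    exact (hu.append_right α).trans ((ih hv).append_left _)

lemma language_eq_yieldLanguage : g.language = yieldLanguage g (.nonterminal g.initial) := by
  refine le_antisymm (fun w hw => ?_) fun w hw => ?_
  · have hmap (w : List T) : w ∈ ((w.map .terminal).map (yieldLanguage g)).prod := by
      induction w with
      | nil => exact Language.nil_mem_one
      | cons t w ih => exact Language.append_mem_mul (singleton_mem_yieldLanguage g t) ih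
    simpa using prod_le_prod_of_derives (fun _ => prod_yieldLanguage_le) hw (hmap w)
  · refine yieldLanguage_le (L := derivedLanguage g) (fun t => .refl _) (fun r hr w hw => ?_) _ hw
    exact Produces.trans_derives ⟨r, hr, ContextFreeRule.Rewrites.input_output⟩
      (derives_of_mem_prod hw)

end Trees

section Ambiguity

variable {T : Type*} {g : ContextFreeGrammar T}

lemma exists_gf2Grammar_of_isUnambiguous (h : g.IsUnambiguous) :
    ∃ G : GF2Grammar T, G.language = g.language := by
  refine ⟨⟨g, fun w => (h w).finite⟩, ?_⟩
  ext w
  rw [language_eq_yieldLanguage]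
  change Odd (g.parseTrees g.initial w).ncard ↔ (g.parseTrees g.initial w).Nonempty
  rcases (h w).eq_empty_or_singleton with hw | ⟨t, ht⟩
  · simp [hw]
  · simp [ht]

/-- A symbol with at least one parse tree, and with finitely many parse trees for each string.
These are the symbols for which sums over all parse trees are considered. -/
def IsFinitary (g : ContextFreeGrammar T) (X : Symbol T g.NT) : Prop :=
  Nonempty (g.ParseTree X) ∧ ∀ w : List T, {t : g.ParseTree X | t.yield = w}.Finite

lemma isFinitary_terminal (t : T) : IsFinitary g (.terminal t) :=
  ⟨⟨.leaf t⟩, fun _ => Set.toFinite _⟩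

instance : Finite {A : g.NT // IsFinitary g (.nonterminal A)} := by
  classical
  refine Set.Finite.subset (g.rules.image (·.input)).finite_toSet ?_
  rintro A ⟨⟨t⟩, -⟩
  cases t with
  | node r hr f => exact Finset.mem_coe.2 (Finset.mem_image_of_mem _ hr)

lemma IsFinitary.of_forest {r : ContextFreeRule T g.NT} (h : IsFinitary g (.nonterminal r.input))
    (hr : r ∈ g.rules) (f : Forest g r.output) : ∀ X ∈ r.output, IsFinitary g X := by
  classical
  intro X hX
  obtain ⟨i, rfl⟩ := List.get_of_mem hX
  refine ⟨⟨f i⟩, fun w => ?_⟩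
  let graft (t : g.ParseTree (r.output.get i)) : g.ParseTree (.nonterminal r.input) :=
    .node r hr (Function.update f i t)
  have graft_injective : graft.Injective := fun t t' htt =>
    Function.update_injective f i (ParseTree.node.inj htt)
  have yield_graft {t t' : g.ParseTree (r.output.get i)} (htt : t.yield = t'.yield) :
      (graft t).yield = (graft t').yield := by
    simp only [graft, yield_node, Forest.yield]
    congr! 3 with j
    obtain rfl | hj := eq_or_ne j i
    · simp only [Function.update_self, htt]
    · simp only [Function.update_of_ne hj]
  obtain hw | ⟨t₀, ht₀⟩ := {t : g.ParseTree (r.output.get i) | t.yield = w}.eq_empty_or_nonempty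
  · exact hw ▸ Set.finite_empty
  · exact .of_finite_image ((h.2 (graft t₀).yield).subset (Set.image_subset_iff.2
      fun t ht => yield_graft (Eq.trans ht (Eq.symm ht₀)))) graft_injective.injOn

/-- The number of internal nodes of a parse tree. -/
def treeSize : {X : Symbol T g.NT} → g.ParseTree X → ℕ
  | _, .leaf _ => 0
  | _, .node _ _ children => 1 + ∑ i, treeSize (children i)

/-- The number of internal nodes of a forest. -/
def Forest.size {α : List (Symbol T g.NT)} (f : Forest g α) : ℕ := ∑ i, treeSize (f i)

lemma treeSize_node (r : ContextFreeRule T g.NT) (hr : r ∈ g.rules) (f : Forest g r.output) :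
    treeSize (ParseTree.node r hr f) = 1 + f.size := by
  rfl

lemma Forest.size_consEquiv {X : Symbol T g.NT} {α : List (Symbol T g.NT)}
    (p : g.ParseTree X × Forest g α) : (consEquiv X α p).size = treeSize p.1 + p.2.size :=
  Fin.sum_univ_succ (n := α.length) fun i => treeSize ((consEquiv X α p) i)

/-- Every parse tree of the first symbol can be turned into a bigger parse tree of the second
symbol for the same string. -/
def Grows (g : ContextFreeGrammar T) (X Y : Symbol T g.NT) : Prop :=
  ∀ t : g.ParseTree X, ∃ t' : g.ParseTree Y, t'.yield = t.yield ∧ treeSize t < treeSize t'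

lemma Grows.trans {X Y Z : Symbol T g.NT} (h : Grows g X Y) (h' : Grows g Y Z) :
    Grows g X Z := by
  intro t
  obtain ⟨t₁, hyield₁, hsize₁⟩ := h t
  obtain ⟨t₂, hyield₂, hsize₂⟩ := h' t₁
  exact ⟨t₂, hyield₂.trans hyield₁, hsize₁.trans hsize₂⟩

lemma IsFinitary.not_grows {X : Symbol T g.NT} (h : IsFinitary g X) : ¬ Grows g X X := by
  intro hX
  obtain ⟨⟨t⟩, hfin⟩ := h
  obtain ⟨t₁, ht₁, hmax⟩ := Set.exists_max_image _ treeSize (hfin t.yield) ⟨t, rfl⟩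
  obtain ⟨t₂, ht₂, hlt⟩ := hX t₁
  exact (hmax t₂ (ht₂.trans ht₁)).not_gt hlt

lemma wellFounded_grows : WellFounded fun A B : {A : g.NT // IsFinitary g (.nonterminal A)} =>
    Grows g (.nonterminal A.1) (.nonterminal B.1) :=
  have : IsTrans {A : g.NT // IsFinitary g (.nonterminal A)} fun A B =>
      Grows g (.nonterminal A.1) (.nonterminal B.1) := ⟨fun _ _ _ => Grows.trans⟩
  have : Std.Irrefl fun A B : {A : g.NT // IsFinitary g (.nonterminal A)} =>
      Grows g (.nonterminal A.1) (.nonterminal B.1) := ⟨fun A => A.2.not_grows⟩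
  Finite.wellFounded_of_trans_of_irrefl _

/-- The rules for a nonterminal all of whose right-hand side symbols are finitary. -/
noncomputable def finitaryRules (g : ContextFreeGrammar T) (A : g.NT) :
    Finset (ContextFreeRule T g.NT) :=
  open Classical in g.rules.filter fun r => r.input = A ∧ ∀ X ∈ r.output, IsFinitary g X

lemma mem_finitaryRules {A : g.NT} {r : ContextFreeRule T g.NT} :
    r ∈ finitaryRules g A ↔ r ∈ g.rules ∧ r.input = A ∧ ∀ X ∈ r.output, IsFinitary g X := by
  simp only [finitaryRules, Finset.mem_filter]

end Ambiguity

/-! ### The Jacobian matrix of a grammar -/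

section LeibnizSum

variable {σ S M : Type*} [CommSemiring S] [AddCommMonoid M] [Module S M]

/-- The right-hand side of the Leibniz rule for the product of the values of a word: the sum, over
all occurrences of a symbol, of the values of `u` before it and of `v` after it, applied to the
value of `d` at it. -/
def leibnizSum (u v : σ → S) (d : σ → M) : List σ → M
  | [] => 0
  | X :: α => u X • leibnizSum u v d α + (α.map v).prod • d X

lemma map_leibnizSum {S' : Type*} [CommSemiring S'] (φ : S →+* S') (u v d : σ → S) (α : List σ) :
    φ (leibnizSum u v d α) = leibnizSum (φ ∘ u) (φ ∘ v) (φ ∘ d) α := by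
  induction α with
  | nil => exact map_zero φ
  | cons X α ih =>
    simp only [leibnizSum, smul_eq_mul, map_add, map_mul, ih, map_list_prod, List.map_map,
      Function.comp_apply]

lemma leibnizSum_eq_sum {N : Type*} [Fintype N] {c : N → σ → S} {u v : σ → S} {d : σ → M}
    {x : N → M} {α : List σ} (hd : ∀ X ∈ α, d X = ∑ B, c B X • x B) :
    leibnizSum u v d α = ∑ B, leibnizSum u v (c B) α • x B := by
  induction α with
  | nil => simp [leibnizSum]
  | cons X α ih =>
    simp only [leibnizSum, ih fun Y hY => hd Y (List.mem_cons_of_mem _ hY), hd X List.mem_cons_self,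
      add_smul, Finset.sum_add_distrib, Finset.smul_sum, smul_assoc]

end LeibnizSum

lemma derivation_list_prod {σ R A M : Type*} [CommSemiring R] [CommSemiring A] [Algebra R A]
    [AddCommGroup M] [Module A M] [Module R M] (D : Derivation R A M) (s : σ → A) (α : List σ) :
    D (α.map s).prod = leibnizSum s s (fun X => D (s X)) α := by
  induction α with
  | nil => exact D.map_one_eq_zero
  | cons X α ih => rw [List.map_cons, List.prod_cons, D.leibniz, ih, leibnizSum]

lemma det_smul_eq_zero {n S M : Type*} [Fintype n] [DecidableEq n] [CommRing S]
    [AddCommGroup M] [Module S M] {A : Matrix n n S} {x : n → M}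
    (hx : ∀ i, ∑ j, A i j • x j = 0) (i : n) : A.det • x i = 0 := by
  calc A.det • x i = ∑ k, (A.adjugate * A) i k • x k := by
        simp [Matrix.adjugate_mul, Matrix.one_apply, ite_smul]
    _ = ∑ j, A.adjugate i j • ∑ k, A j k • x k := by
        simp only [Matrix.mul_apply, Finset.sum_smul, Finset.smul_sum, mul_smul]
        exact Finset.sum_comm
    _ = 0 := by simp only [hx, smul_zero, Finset.sum_const_zero]

section Jacobian

variable {T : Type*} {g : ContextFreeGrammar T}

/-- The finitary nonterminals, which index the polynomial system of a grammar. -/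
abbrev FinitaryNT (g : ContextFreeGrammar T) : Type _ := {A : g.NT // IsFinitary g (.nonterminal A)}

noncomputable instance : Fintype (FinitaryNT g) := Fintype.ofFinite _

noncomputable instance : DecidableEq (FinitaryNT g) := Classical.decEq _

open Classical in
/-- The Jacobian matrix of the system of equations `A = ∑ α`, with `A → α` ranging over the finitary
rules for `A`. In the noncommutative setting a partial derivative has separate arguments `u` and `v`
for the symbols before and after the differentiated one. -/
noncomputable def jacobian {S : Type*} [CommSemiring S] (u v : Symbol T g.NT → S) :
    Matrix (FinitaryNT g) (FinitaryNT g) S :=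
  fun A B => ∑ r ∈ finitaryRules g A.1, leibnizSum u v (Pi.single (.nonterminal B.1) 1) r.output

lemma map_det_one_sub_jacobian {S S' : Type*} [CommRing S] [CommRing S'] (φ : S →+* S')
    (u v : Symbol T g.NT → S) :
    φ (1 - jacobian u v).det = (1 - jacobian (φ ∘ u) (φ ∘ v)).det := by
  classical
  have hφ : (jacobian u v).map φ = jacobian (φ ∘ u) (φ ∘ v) := by
    ext A B
    simp only [Matrix.map_apply, jacobian, map_sum, map_leibnizSum]
    congr! 2
    ext X
    simp only [Function.comp_apply, Pi.single_apply, apply_ite φ, map_one, map_zero]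
  rw [RingHom.map_det, map_sub, map_one, RingHom.mapMatrix_apply, hφ]

lemma det_one_sub_jacobian_smul_eq_zero {S M : Type*} [CommRing S] [AddCommGroup M] [Module S M]
    {u v : Symbol T g.NT → S} {d : Symbol T g.NT → M} (hd : ∀ t, d (.terminal t) = 0)
    (hsum : ∀ A, IsFinitary g (.nonterminal A) →
      d (.nonterminal A) = ∑ r ∈ finitaryRules g A, leibnizSum u v d r.output)
    (A : FinitaryNT g) : (1 - jacobian u v).det • d (.nonterminal A.1) = 0 := by
  classical
  have hexpand (X : Symbol T g.NT) (hX : IsFinitary g X) : d X = ∑ B : FinitaryNT g,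
      Pi.single (M := fun _ => S) (.nonterminal B.1) 1 X • d (.nonterminal B.1) := by
    rcases X with t | C
    · simp [hd]
    · rw [Finset.sum_eq_single ⟨C, hX⟩]
      · simp
      · rintro B - hB
        rw [Pi.single_eq_of_ne, zero_smul]
        exact fun h => hB (Subtype.ext (Symbol.nonterminal.inj h).symm)
      · simp
  refine det_smul_eq_zero (x := fun B : FinitaryNT g => d (.nonterminal B.1)) (fun A => ?_) A
  simp only [Matrix.sub_apply, sub_smul, Finset.sum_sub_distrib, Matrix.one_apply, ite_smul,
    one_smul, zero_smul, Finset.sum_ite_eq, Finset.mem_univ, if_true, jacobian, Finset.sum_smul]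
  rw [hsum A.1 A.2, Finset.sum_comm, sub_eq_zero]
  exact Finset.sum_congr rfl fun r hr =>
    leibnizSum_eq_sum fun X hX => hexpand X ((mem_finitaryRules.1 hr).2.2 X hX)

end Jacobian

section Nonsingular

variable {T S : Type*} {g : ContextFreeGrammar T} [CommSemiring S] {e : Symbol T g.NT → S}

lemma exists_forest_of_prod_ne_zero (he : ∀ X, e X ≠ 0 → [] ∈ yieldLanguage g X)
    {α : List (Symbol T g.NT)} (h : (α.map e).prod ≠ 0) : ∃ f : Forest g α, f.yield = [] := by
  induction α with
  | nil => exact ⟨default, rfl⟩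
  | cons X α ih =>
    rw [List.map_cons, List.prod_cons] at h
    obtain ⟨f, hf⟩ := ih (right_ne_zero_of_mul h)
    obtain ⟨t, ht⟩ := he X (left_ne_zero_of_mul h)
    exact ⟨Forest.consEquiv X α (t, f), by rw [Forest.yield_consEquiv, ht, hf, List.nil_append]⟩

lemma exists_forest_of_leibnizSum_ne_zero [DecidableEq (Symbol T g.NT)]
    (he : ∀ X, e X ≠ 0 → [] ∈ yieldLanguage g X) {Y : Symbol T g.NT} {α : List (Symbol T g.NT)}
    (h : leibnizSum e e (Pi.single Y (1 : S)) α ≠ 0) (t : g.ParseTree Y) :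
    ∃ f : Forest g α, f.yield = t.yield ∧ treeSize t ≤ f.size := by
  induction α with
  | nil => exact absurd rfl h
  | cons X α ih =>
    by_cases hα : e X • leibnizSum e e (Pi.single Y (1 : S)) α = 0
    · rw [leibnizSum, hα, zero_add, smul_eq_mul] at h
      obtain rfl : X = Y := by
        by_contra hXY
        exact right_ne_zero_of_mul h (Pi.single_eq_of_ne hXY 1)
      obtain ⟨f, hf⟩ := exists_forest_of_prod_ne_zero he (left_ne_zero_of_mul h)
      exact ⟨Forest.consEquiv _ α (t, f), by rw [Forest.yield_consEquiv, hf, List.append_nil],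
        Forest.size_consEquiv (t, f) ▸ Nat.le_add_right _ _⟩
    · obtain ⟨f, hf, hsize⟩ := ih (right_ne_zero_of_mul hα)
      obtain ⟨t', ht'⟩ := he X (left_ne_zero_of_mul hα)
      exact ⟨Forest.consEquiv X α (t', f),
        by rw [Forest.yield_consEquiv, hf, ht', List.nil_append],
        Forest.size_consEquiv (t', f) ▸ hsize.trans (Nat.le_add_left _ _)⟩

lemma grows_of_jacobian_ne_zero (he : ∀ X, e X ≠ 0 → [] ∈ yieldLanguage g X)
    {A B : FinitaryNT g} (h : jacobian e e A B ≠ 0) :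
    Grows g (.nonterminal B.1) (.nonterminal A.1) := by
  classical
  intro t
  obtain ⟨r, hr, hne⟩ := Finset.exists_ne_zero_of_sum_ne_zero h
  obtain ⟨hr', hA, -⟩ := mem_finitaryRules.1 hr
  obtain ⟨f, hf, hsize⟩ := exists_forest_of_leibnizSum_ne_zero he hne t
  rw [← hA]
  exact ⟨.node r hr' f, hf, by rw [treeSize_node]; lia⟩

/-- A nonzero vector in the kernel would propagate along the relation `Grows`, which is
well-founded because iterating it yields arbitrarily large parse trees of the same string. -/
lemma det_one_sub_jacobian_ne_zero {K : Type*} [Field K] {e : Symbol T g.NT → K}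
    (he : ∀ X, e X ≠ 0 → [] ∈ yieldLanguage g X) : (1 - jacobian e e).det ≠ 0 := by
  intro h
  obtain ⟨x, hx, h⟩ := Matrix.exists_mulVec_eq_zero_iff.2 h
  refine hx (funext fun A => ?_)
  induction A using (wellFounded_grows (g := g)).induction with
  | _ A ih =>
    have hA := congrFun h A
    rw [Matrix.sub_mulVec, Matrix.one_mulVec, Pi.sub_apply, Pi.zero_apply, sub_eq_zero] at hA
    rw [hA]
    refine Finset.sum_eq_zero fun B _ => ?_
    by_cases hB : jacobian e e A B = 0
    · exact mul_eq_zero_of_left hB _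
    · rw [ih B (grows_of_jacobian_ne_zero he hB), Pi.zero_apply, mul_zero]

end Nonsingular

/-! ### Algebraicity of solutions -/

section Algebraic

variable {K L : Type*} [Field K] [Field L] [Algebra K L]

lemma derivation_adjoin_eq_zero {M : Type*} {S : Set L} [AddCommGroup M] [Module K M]
    [Module (IntermediateField.adjoin K S) M] {D : Derivation K (IntermediateField.adjoin K S) M}
    (hD : ∀ x : IntermediateField.adjoin K S, x.1 ∈ S → D x = 0)
    (x : IntermediateField.adjoin K S) : D x = 0 := by
  obtain ⟨x, hx⟩ := x
  induction hx using IntermediateField.adjoin_induction with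
  | mem x hx => exact hD _ hx
  | algebraMap x => exact D.map_algebraMap x
  | add x y hx hy hDx hDy =>
    exact (D.map_add ⟨x, hx⟩ ⟨y, hy⟩).trans (by rw [hDx, hDy, add_zero])
  | inv x hx hDx => exact (D.leibniz_inv ⟨x, hx⟩).trans (by rw [hDx, smul_zero])
  | mul x y hx hy hDx hDy =>
    exact (D.leibniz ⟨x, hx⟩ ⟨y, hy⟩).trans (by rw [hDx, hDy, smul_zero, smul_zero, add_zero])

lemma isAlgebraic_adjoin_of_kaehlerDifferential_eq_zero {S : Set L} (hS : S.Finite)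
    (hD : ∀ x : IntermediateField.adjoin K S, x.1 ∈ S → KaehlerDifferential.D K _ x = 0) :
    Algebra.IsAlgebraic K (IntermediateField.adjoin K S) := by
  have : Algebra.FormallyUnramified K (IntermediateField.adjoin K S) := by
    refine ⟨Submodule.subsingleton_iff (IntermediateField.adjoin K S) |>.1
      (subsingleton_of_bot_eq_top ?_)⟩
    rw [← KaehlerDifferential.span_range_derivation, eq_comm, Submodule.span_eq_bot]
    rintro _ ⟨x, rfl⟩
    exact derivation_adjoin_eq_zero hD x
  have : Algebra.EssFiniteType K (IntermediateField.adjoin K S) :=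
    IntermediateField.essFiniteType_iff.2 (IntermediateField.fg_adjoin_of_finite hS)
  have : Algebra.IsSeparable K (IntermediateField.adjoin K S) :=
    Algebra.FormallyUnramified.isSeparable K _
  infer_instance

variable {T : Type*} {g : ContextFreeGrammar T}

/-- Differentiating the polynomial system, Cramer's rule shows that every `K`-derivation of the
field generated by the solution vanishes. -/
lemma isAlgebraic_field_of_det_ne_zero {s : Symbol T g.NT → L}
    (hterminal : ∀ t, s (.terminal t) ∈ (algebraMap K L).range)
    (hs : ∀ X, ¬ IsFinitary g X → s X = 0)
    (hsum : ∀ A, IsFinitary g (.nonterminal A) →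
      s (.nonterminal A) = ∑ r ∈ finitaryRules g A, (r.output.map s).prod)
    (hdet : (1 - jacobian s s).det ≠ 0) (X : Symbol T g.NT) : IsAlgebraic K (s X) := by
  let E := IntermediateField.adjoin K (Set.range fun A : FinitaryNT g => s (.nonterminal A.1))
  have hE (X : Symbol T g.NT) : s X ∈ E := by
    by_cases hX : IsFinitary g X
    · rcases X with t | A
      · obtain ⟨k, hk⟩ := hterminal t
        exact hk ▸ E.algebraMap_mem k
      · exact IntermediateField.subset_adjoin _ _ ⟨⟨A, hX⟩, rfl⟩
    · exact hs X hX ▸ E.zero_mem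
  let s' (X : Symbol T g.NT) : E := ⟨s X, hE X⟩
  have hdet' : (1 - jacobian s' s').det ≠ 0 := fun h =>
    hdet ((map_det_one_sub_jacobian E.val.toRingHom s' s').symm.trans (by rw [h, map_zero]))
  have hD (A : FinitaryNT g) : KaehlerDifferential.D K E (s' (.nonterminal A.1)) = 0 := by
    refine (smul_eq_zero.1 (det_one_sub_jacobian_smul_eq_zero (u := s') (v := s')
      (d := fun X => KaehlerDifferential.D K E (s' X)) (fun t => ?_) (fun A hA => ?_)
      A)).resolve_left hdet'
    · obtain ⟨k, hk⟩ := hterminal t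
      have hk' : s' (.terminal t) = algebraMap K E k := Subtype.ext hk.symm
      rw [hk', Derivation.map_algebraMap]
    · have hA' : s' (.nonterminal A) = ∑ r ∈ finitaryRules g A, (r.output.map s').prod := by
        apply E.val.injective
        simp only [map_sum, map_list_prod, List.map_map]
        exact hsum A hA
      simp only [hA', map_sum, derivation_list_prod]
  have := isAlgebraic_adjoin_of_kaehlerDifferential_eq_zero (K := K) (Set.finite_range _)
    (by rintro ⟨_, _⟩ ⟨A, rfl⟩; exact hD A)
  exact (Algebra.IsAlgebraic.isAlgebraic (R := K) (s' X)).algebraMap (A := L)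

theorem isAlgebraic_of_det_ne_zero {R A : Type*} [CommRing R] [IsDomain R] [CommRing A] [IsDomain A]
    [Algebra R A] [FaithfulSMul R A] {s : Symbol T g.NT → A}
    (hterminal : ∀ t, s (.terminal t) ∈ (algebraMap R A).range)
    (hs : ∀ X, ¬ IsFinitary g X → s X = 0)
    (hsum : ∀ A, IsFinitary g (.nonterminal A) →
      s (.nonterminal A) = ∑ r ∈ finitaryRules g A, (r.output.map s).prod)
    (hdet : (1 - jacobian s s).det ≠ 0) (X : Symbol T g.NT) : IsAlgebraic R (s X) := by
  let φ := algebraMap A (FractionRing A)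
  have hφ : Function.Injective φ := IsFractionRing.injective A _
  let : Algebra (FractionRing R) (FractionRing A) := FractionRing.liftAlgebra R _
  have : IsScalarTower R (FractionRing R) (FractionRing A) :=
    FractionRing.isScalarTower_liftAlgebra R _
  have hX : IsAlgebraic (FractionRing R) ((φ ∘ s) X) := by
    refine isAlgebraic_field_of_det_ne_zero (g := g) (fun t => ?_) (fun X hX => ?_) (fun A hA => ?_)
      ?_ X
    · obtain ⟨r, hr⟩ := hterminal t
      exact ⟨algebraMap R _ r, by
        rw [← IsScalarTower.algebraMap_apply, Function.comp_apply, ← hr,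
          IsScalarTower.algebraMap_apply R A]⟩
    · rw [Function.comp_apply, hs X hX, map_zero]
    · simp only [Function.comp_apply, hsum A hA, map_sum, map_list_prod, List.map_map]
    · rwa [← map_det_one_sub_jacobian, Ne, map_eq_zero_iff φ hφ]
  exact (isAlgebraic_algebraMap_iff hφ).1 ((IsFractionRing.isAlgebraic_iff R _ _).2 hX)

end Algebraic

/-! ### Algebraic power series in few variables -/

section Subalgebras

open MvPowerSeries

variable {ι : Type*} (K : Type*) [Field K]

instance : IsDomain (MvPowerSeries ι K) := NoZeroDivisors.to_isDomain _

/-- The polynomials in the variables from `σ`, as power series. -/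
noncomputable def polySub (σ : Set ι) : Subalgebra K (MvPowerSeries ι K) :=
  Algebra.adjoin K (X '' σ)

/-- The power series in which only the variables from `σ` occur. -/
def supportedSub (σ : Set ι) : Subalgebra K (MvPowerSeries ι K) where
  carrier := {f | ∀ m, coeff m f ≠ 0 → (m.support : Set ι) ⊆ σ}
  mul_mem' {f h} hf hh m hm := by
    classical
    rw [coeff_mul] at hm
    obtain ⟨p, hp, hne⟩ := Finset.exists_ne_zero_of_sum_ne_zero hm
    rw [← Finset.HasAntidiagonal.mem_antidiagonal.1 hp]
    refine subset_trans (Finset.coe_subset.2 Finsupp.support_add) ?_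
    rw [Finset.coe_union]
    exact Set.union_subset (hf _ (left_ne_zero_of_mul hne)) (hh _ (right_ne_zero_of_mul hne))
  add_mem' {f h} hf hh m hm := by
    rw [map_add] at hm
    by_cases hfm : coeff m f = 0
    · rw [hfm, zero_add] at hm
      exact hh m hm
    · exact hf m hfm
  algebraMap_mem' r m hm := by
    classical
    rw [MvPowerSeries.algebraMap_apply, coeff_C] at hm
    obtain rfl : m = 0 := by_contra fun h => hm (if_neg h)
    simp

/-- The power series that are algebraic over the polynomials in the variables from `σ`. -/
noncomputable def algSub (σ : Set ι) : Subalgebra K (MvPowerSeries ι K) :=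
  (Subalgebra.algebraicClosure (polySub K σ) (MvPowerSeries ι K)).restrictScalars K

/-- The algebraic power series in the single variable `i`. -/
noncomputable def algVar (i : ι) : Subalgebra K (MvPowerSeries ι K) :=
  algSub K {i} ⊓ supportedSub K {i}

/-- The subalgebra generated by the algebraic power series in one variable from `σ`. -/
noncomputable def algTensor (σ : Set ι) : Subalgebra K (MvPowerSeries ι K) :=
  ⨆ i ∈ σ, algVar K i

/-- The nonzero polynomials in the variables from `σ`. -/
noncomputable def polyNonzero (σ : Set ι) : Submonoid (MvPowerSeries ι K) :=
  (polySub K σ).toSubmonoid ⊓ nonZeroDivisors _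

variable (ι) in
/-- Products of nonzero polynomials in two variables each. -/
noncomputable def pairDenominators : Submonoid (MvPowerSeries ι K) :=
  ⨆ (i : ι) (j : ι), polyNonzero K {i, j}

variable {K} {σ τ : Set ι}

lemma X_mem_polySub {i : ι} (hi : i ∈ σ) : X i ∈ polySub K σ :=
  Algebra.subset_adjoin ⟨i, hi, rfl⟩

lemma mem_polySub {x : MvPowerSeries ι K} :
    x ∈ polySub K σ ↔ ∃ p ∈ MvPolynomial.supported K σ, (p : MvPowerSeries ι K) = x := by
  have hmap : polySub K σ =
      (MvPolynomial.supported K σ).map (MvPolynomial.coeToMvPowerSeries.algHom K) := by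
    simp [polySub, MvPolynomial.supported_eq_adjoin_X, AlgHom.map_adjoin, Set.image_image]
  simp [hmap]

lemma polySub_mono (h : σ ⊆ τ) : polySub K σ ≤ polySub K τ :=
  Algebra.adjoin_mono (Set.image_mono h)

lemma supportedSub_mono (h : σ ⊆ τ) : supportedSub K σ ≤ supportedSub K τ :=
  fun _ hf m hm => (hf m hm).trans h

lemma mem_algSub {x : MvPowerSeries ι K} : x ∈ algSub K σ ↔ IsAlgebraic (polySub K σ) x :=
  Iff.rfl

lemma algSub_mono (h : σ ⊆ τ) : algSub K σ ≤ algSub K τ :=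
  fun _ hx => mem_algSub.2 ((mem_algSub.1 hx).tower_top_of_subalgebra_le (polySub_mono h))

lemma polySub_le_algSub (σ : Set ι) : polySub K σ ≤ algSub K σ :=
  fun x hx => isAlgebraic_algebraMap (⟨x, hx⟩ : polySub K σ)

lemma algVar_le_algTensor {i : ι} (hi : i ∈ σ) : algVar K i ≤ algTensor K σ :=
  le_iSup₂_of_le i hi le_rfl

lemma algTensor_mono (h : σ ⊆ τ) : algTensor K σ ≤ algTensor K τ :=
  iSup₂_le fun _ hi => algVar_le_algTensor (h hi)

lemma algTensor_le_algSub (σ : Set ι) : algTensor K σ ≤ algSub K σ :=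
  iSup₂_le fun _ hi => inf_le_left.trans (algSub_mono (Set.singleton_subset_iff.2 hi))

lemma X_mem_supportedSub {i : ι} (hi : i ∈ σ) : X i ∈ supportedSub K σ := by
  classical
  intro m hm
  rw [coeff_X] at hm
  obtain rfl : m = Finsupp.single i 1 := by_contra fun h => hm (if_neg h)
  exact (Finset.coe_subset.2 Finsupp.support_single_subset).trans (by simpa using hi)

lemma X_mem_algVar (i : ι) : X i ∈ algVar K i :=
  ⟨polySub_le_algSub _ (X_mem_polySub rfl), X_mem_supportedSub rfl⟩

lemma polySub_le_algTensor (σ : Set ι) : polySub K σ ≤ algTensor K σ := by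
  rw [polySub, Algebra.adjoin_le_iff]
  rintro _ ⟨i, hi, rfl⟩
  exact algVar_le_algTensor hi (X_mem_algVar i)

lemma exists_mul_mem_polyNonzero {x : MvPowerSeries ι K} (hx : x ∈ algTensor K σ) (h0 : x ≠ 0) :
    ∃ y ∈ algTensor K σ, x * y ∈ polyNonzero K σ := by
  obtain ⟨y, hy, p, hp, h⟩ := IsAlgebraic.exists_nonzero_eq_adjoin_mul
    (mem_algSub.1 (algTensor_le_algSub σ hx)) (mem_nonZeroDivisors_of_ne_zero h0)
  refine ⟨y, ?_, h ▸ ⟨p.2, mem_nonZeroDivisors_of_ne_zero fun h' => hp (Subtype.ext h')⟩⟩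
  clear h
  induction hy using Algebra.adjoin_induction with
  | mem y hy => rwa [Set.mem_singleton_iff.1 hy]
  | algebraMap q => exact polySub_le_algTensor σ q.2
  | add _ _ _ _ h h' => exact add_mem h h'
  | mul _ _ _ _ h h' => exact mul_mem h h'

lemma pairDenominators_le :
    pairDenominators ι K ≤ (algTensor K (Set.univ : Set ι)).toSubmonoid :=
  iSup₂_le fun i j _ hx => algTensor_mono (Set.subset_univ {i, j}) (polySub_le_algTensor _ hx.1)

variable (ι K) in
/-- The power series that are fractions with a numerator generated by algebraic power series in one
variable and with a denominator that is a product of polynomials in two variables each. -/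
def pairFractions : Subalgebra K (MvPowerSeries ι K) where
  carrier := {x | ∃ p ∈ pairDenominators ι K, p * x ∈ algTensor K Set.univ}
  mul_mem' := by
    rintro x y ⟨p, hp, hx⟩ ⟨q, hq, hy⟩
    exact ⟨p * q, mul_mem hp hq, by rw [mul_mul_mul_comm]; exact mul_mem hx hy⟩
  add_mem' := by
    rintro x y ⟨p, hp, hx⟩ ⟨q, hq, hy⟩
    refine ⟨p * q, mul_mem hp hq, ?_⟩
    rw [show p * q * (x + y) = q * (p * x) + p * (q * y) by ring]
    exact add_mem (mul_mem (pairDenominators_le hq) hx) (mul_mem (pairDenominators_le hp) hy)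
  algebraMap_mem' r := ⟨1, one_mem _, by rw [one_mul]; exact Subalgebra.algebraMap_mem _ r⟩

lemma algTensor_le_pairFractions (σ : Set ι) : algTensor K σ ≤ pairFractions ι K :=
  fun x hx => ⟨1, one_mem _, by rw [one_mul]; exact algTensor_mono (Set.subset_univ σ) hx⟩

lemma mem_pairFractions_of_mul_mem {i j : ι} {d x : MvPowerSeries ι K}
    (hd : d ∈ algTensor K {i, j}) (h0 : d ≠ 0) (h : d * x ∈ pairFractions ι K) :
    x ∈ pairFractions ι K := by
  obtain ⟨y, hy, hdy⟩ := exists_mul_mem_polyNonzero hd h0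
  obtain ⟨q, hq, hqdx⟩ := h
  have hle : polyNonzero K {i, j} ≤ pairDenominators ι K := le_iSup₂_of_le i j le_rfl
  refine ⟨d * y * q, mul_mem (hle hdy) hq, ?_⟩
  rw [show d * y * q * x = y * (q * (d * x)) by ring]
  exact mul_mem (algTensor_mono (Set.subset_univ _) hy) hqdx

end Subalgebras

/-! ### Summation over all parse trees -/

section TreeSum

variable {T A : Type*} {g : ContextFreeGrammar T} [Ring A] [UniformSpace A]

/-- The sum, over all parse trees with a given root, of the products of the values of `φ` at the
letters of their yields; it is set to zero for symbols that are not finitary. -/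
noncomputable def treeSum (φ : T → A) (X : Symbol T g.NT) : A :=
  open Classical in if IsFinitary g X then ∑' t : g.ParseTree X, (t.yield.map φ).prod else 0

lemma treeSum_of_not_isFinitary (φ : T → A) {X : Symbol T g.NT} (hX : ¬ IsFinitary g X) :
    treeSum φ X = 0 :=
  if_neg hX

/-- The condition that the sums over all parse trees of finitary symbols converge. -/
def IsTreeSummable (g : ContextFreeGrammar T) (φ : T → A) : Prop :=
  ∀ X, IsFinitary g X → Summable fun t : g.ParseTree X => (t.yield.map φ).prod

variable {φ : T → A}

lemma IsTreeSummable.hasSum_treeSum (hφ : IsTreeSummable g φ) {X : Symbol T g.NT}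
    (hX : IsFinitary g X) :
    HasSum (fun t : g.ParseTree X => (t.yield.map φ).prod) (treeSum φ X) := by
  rw [treeSum, if_pos hX]
  exact (hφ X hX).hasSum

lemma IsTreeSummable.treeSum_terminal [T2Space A] (hφ : IsTreeSummable g φ) (t : T) :
    treeSum φ (.terminal t : Symbol T g.NT) = φ t := by
  refine (hφ.hasSum_treeSum (isFinitary_terminal t)).unique ?_
  convert hasSum_unique fun s : g.ParseTree (.terminal t) => (s.yield.map φ).prod
  rw [show (default : g.ParseTree (.terminal t)) = .leaf t from rfl, yield_leaf,
    List.map_singleton, List.prod_singleton]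

variable [IsUniformAddGroup A] [NonarchimedeanRing A]

lemma IsTreeSummable.hasSum_forest (hφ : IsTreeSummable g φ) {α : List (Symbol T g.NT)}
    (hα : ∀ X ∈ α, IsFinitary g X) :
    HasSum (fun f : Forest g α => (f.yield.map φ).prod) (α.map (treeSum φ)).prod := by
  induction α with
  | nil => exact hasSum_unique _
  | cons X α ih =>
    rw [← (Forest.consEquiv X α).hasSum_iff, List.map_cons, List.prod_cons]
    convert (hφ.hasSum_treeSum (hα X List.mem_cons_self)).mul_of_nonarchimedean
      (ih fun Y hY => hα Y (List.mem_cons_of_mem X hY)) using 2 with p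
    rw [Function.comp_apply, Forest.yield_consEquiv, List.map_append, List.prod_append]

lemma IsTreeSummable.treeSum_nonterminal [T2Space A] (hφ : IsTreeSummable g φ) {A : g.NT}
    (hA : IsFinitary g (.nonterminal A)) :
    treeSum φ (.nonterminal A : Symbol T g.NT) =
      ∑ r ∈ finitaryRules g A, (r.output.map (treeSum φ)).prod := by
  classical
  have hsum := hφ.hasSum_treeSum hA
  rw [← (nodeEquiv A).hasSum_iff] at hsum
  have hfiber (r : {r : ContextFreeRule T g.NT // r ∈ g.rules ∧ r.input = A}) :
      HasSum (fun f : Forest g r.1.output => ((nodeEquiv A ⟨r, f⟩).yield.map φ).prod)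
        (if ∀ X ∈ r.1.output, IsFinitary g X then (r.1.output.map (treeSum φ)).prod else 0) := by
    simp only [yield_nodeEquiv]
    split_ifs with hr
    · exact hφ.hasSum_forest hr
    · have : IsEmpty (Forest g r.1.output) :=
        ⟨fun f => hr (IsFinitary.of_forest (by rwa [r.2.2]) r.2.1 f)⟩
      exact hasSum_empty
  have : Fintype {r : ContextFreeRule T g.NT // r ∈ g.rules ∧ r.input = A} :=
    .subtype (g.rules.filter (·.input = A)) fun r => Finset.mem_filter
  rw [(hsum.sigma hfiber).unique (hasSum_fintype _), ← Finset.sum_filter]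
  refine Finset.sum_bij (fun r _ => r.1) (fun r hr => ?_) (fun _ _ _ _ => Subtype.ext)
    (fun r hr => ?_) fun _ _ => rfl
  · exact mem_finitaryRules.2 ⟨r.2.1, r.2.2, (Finset.mem_filter.1 hr).2⟩
  · obtain ⟨hmem, hinput, hfinitary⟩ := mem_finitaryRules.1 hr
    exact ⟨⟨r, hmem, hinput⟩, by simpa using hfinitary, rfl⟩

end TreeSum

section Nonarchimedean

open scoped MvPowerSeries.WithPiTopology

instance {K : Type*} [Ring K] [TopologicalSpace K] [DiscreteTopology K] :
    NonarchimedeanRing K where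
  is_nonarchimedean _ hU :=
    ⟨⟨⊥, isOpen_discrete _⟩, Set.singleton_subset_iff.2 (mem_of_mem_nhds hU)⟩

instance {κ : Type*} {M : κ → Type*} [∀ k, AddGroup (M k)] [∀ k, TopologicalSpace (M k)]
    [∀ k, NonarchimedeanAddGroup (M k)] : NonarchimedeanAddGroup (∀ k, M k) where
  is_nonarchimedean U hU := by
    rw [nhds_pi, Filter.mem_pi] at hU
    obtain ⟨I, hI, t, ht, htU⟩ := hU
    choose V hV using fun k => NonarchimedeanAddGroup.is_nonarchimedean (t k) (ht k)
    exact ⟨⟨AddSubgroup.pi I fun k => (V k).toAddSubgroup,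
      isOpen_set_pi hI fun k _ => (V k).isOpen⟩, (Set.pi_mono fun k _ => hV k).trans htU⟩

instance {ι K : Type*} [Ring K] [TopologicalSpace K] [NonarchimedeanRing K] :
    NonarchimedeanRing (MvPowerSeries ι K) where
  is_nonarchimedean := NonarchimedeanAddGroup.is_nonarchimedean (G := (ι →₀ ℕ) → K)

instance {ι R : Type*} [Fintype ι] [DecidableEq ι] [Ring R] [TopologicalSpace R]
    [NonarchimedeanRing R] : NonarchimedeanRing (Matrix ι ι R) where
  is_nonarchimedean := NonarchimedeanAddGroup.is_nonarchimedean (G := ι → ι → R)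

end Nonarchimedean

section TreeSum

variable {T A R : Type*} {g : ContextFreeGrammar T} [Ring A] [UniformSpace A] {φ : T → A}
  {X : Symbol T g.NT} [TopologicalSpace R] [T2Space R]

lemma IsTreeSummable.exists_map_ne_zero (hφ : IsTreeSummable g φ) [AddCommMonoid R] {ψ : A →+ R}
    (hψ : Continuous ψ) (h : ψ (treeSum φ X) ≠ 0) :
    ∃ t : g.ParseTree X, ψ (t.yield.map φ).prod ≠ 0 := by
  by_contra! h0
  by_cases hX : IsFinitary g X
  · have hsum := (hφ.hasSum_treeSum hX).map ψ hψ
    simp only [Function.comp_def, h0] at hsum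
    exact h (hsum.unique hasSum_zero)
  · exact h (by rw [treeSum_of_not_isFinitary φ hX, map_zero])

lemma IsTreeSummable.map_treeSum_eq_ncard (hφ : IsTreeSummable g φ) [AddCommMonoidWithOne R]
    {ψ : A →+ R} (hψ : Continuous ψ) (hX : IsFinitary g X) {w₀ : List T}
    (h : ∀ w, ψ (w.map φ).prod = open Classical in if w = w₀ then 1 else 0) :
    ψ (treeSum φ X) = ({t : g.ParseTree X | t.yield = w₀}.ncard : R) := by
  classical
  have hsum := (hφ.hasSum_treeSum hX).map ψ hψ
  simp only [Function.comp_def, h] at hsum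
  rw [hsum.unique (hasSum_sum_of_ne_finset_zero (s := (hX.2 w₀).toFinset)
      (by simp +contextual)),
    Set.ncard_eq_toFinset_card _ (hX.2 w₀), ← nsmul_one, ← Finset.sum_const]
  exact Finset.sum_congr rfl fun t ht => if_pos ((hX.2 w₀).mem_toFinset.1 ht)

end TreeSum

/-! ### Counting trees with sorted yields -/

section LetterMatrix

open MvPowerSeries

variable {T ι : Type*} (K : Type*) [Field K] [LinearOrder ι] (ℓ : ι ↪ T)

/-- The transition matrix of a letter in the automaton that reads the words over the letters `ℓ i`
whose indices increase weakly: the state is the index of the last letter read, and reading `ℓ i`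
contributes the variable `X i`. -/
noncomputable def letterMatrix (t : T) : Matrix ι ι (MvPowerSeries ι K) :=
  open Classical in .of fun i j => if t = ℓ j ∧ i ≤ j then X j else 0

/-- The word with letters `ℓ i`, in increasing order of `i`, in which `ℓ i` occurs `m i` times. -/
noncomputable def sortedWord (m : ι →₀ ℕ) : List T :=
  (m.toMultiset.sort (· ≤ ·)).map ℓ

variable {K ℓ}

lemma letterMatrix_apply [DecidableEq T] (t : T) (i j : ι) :
    letterMatrix K ℓ t i j = if t = ℓ j ∧ i ≤ j then X j else 0 := by
  rw [letterMatrix, Matrix.of_apply]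
  congr

lemma letterMatrix_of_notMem_range {t : T} (ht : t ∉ Set.range ℓ) : letterMatrix K ℓ t = 0 := by
  classical
  ext1 i j
  rw [letterMatrix_apply, if_neg fun h => ht ⟨j, h.1.symm⟩, Matrix.zero_apply]

lemma isUpperTriangular_letterMatrix (t : T) : (letterMatrix K ℓ t).IsUpperTriangular := by
  classical
  intro i j hij
  rw [letterMatrix_apply, if_neg fun h => h.2.not_gt hij]

lemma coeff_prod_map_X (m : ι →₀ ℕ) (v : List ι) :
    coeff m (v.map X).prod = if (v : Multiset ι).toFinsupp = m then (1 : K) else 0 := by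
  have (v : List ι) : (v.map X).prod = monomial (v : Multiset ι).toFinsupp (1 : K) := by
    induction v with
    | nil => simp
    | cons k v ih =>
      rw [List.map_cons, List.prod_cons, ih, X, monomial_mul_monomial, mul_one,
        ← Multiset.cons_coe, ← Multiset.singleton_add, Multiset.toFinsupp_add,
        Multiset.toFinsupp_singleton]
  simp only [this, coeff_monomial, eq_comm]

lemma sortedWord_toFinsupp {v : List ι} (hv : v.Pairwise (· ≤ ·)) :
    sortedWord ℓ (v : Multiset ι).toFinsupp = v.map ℓ := by
  rw [sortedWord, Multiset.toFinsupp_toMultiset]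
  refine congrArg (List.map ℓ) (List.Perm.eq_of_pairwise' (Multiset.pairwise_sort _ _) hv ?_)
  exact Multiset.coe_eq_coe.1 (Multiset.sort_eq _ _)

variable [Fintype ι]

lemma prod_letterMatrix_map_apply (v : List ι) (i j : ι) :
    ((v.map ℓ).map (letterMatrix K ℓ)).prod i j =
      if (i :: v).IsChain (· ≤ ·) ∧ v.getLastD i = j then (v.map X).prod else 0 := by
  classical
  induction v generalizing i with
  | nil => simp [Matrix.one_apply]
  | cons k v ih =>
    rw [List.map_cons, List.map_cons, List.prod_cons, Matrix.mul_apply, Fintype.sum_eq_single k,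
      ih, letterMatrix_apply, ite_zero_mul_ite_zero, List.map_cons, List.prod_cons]
    · simp only [List.isChain_cons_cons, List.getLastD_cons, true_and, and_assoc]
    · intro k' hk
      rw [letterMatrix_apply, if_neg fun h => hk (ℓ.injective h.1).symm, zero_mul]

lemma exists_map_eq_of_prod_letterMatrix_ne_zero {w : List T}
    (h : (w.map (letterMatrix K ℓ)).prod ≠ 0) : ∃ v : List ι, v.map ℓ = w := by
  rw [← Set.mem_range, Set.range_list_map]
  by_contra! hw
  obtain ⟨t, ht, htℓ⟩ := not_forall₂.1 hw
  exact h (List.prod_eq_zero (List.mem_map.2 ⟨t, ht, letterMatrix_of_notMem_range htℓ⟩))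

lemma eq_sortedWord_of_coeff_ne_zero {m : ι →₀ ℕ} {w : List T} {i j : ι}
    (h : coeff m ((w.map (letterMatrix K ℓ)).prod i j) ≠ 0) : w = sortedWord ℓ m := by
  obtain ⟨v, rfl⟩ := exists_map_eq_of_prod_letterMatrix_ne_zero (K := K) (ℓ := ℓ) (w := w)
    fun h0 => h (by rw [h0, Matrix.zero_apply, map_zero])
  rw [prod_letterMatrix_map_apply] at h
  split_ifs at h with hv
  · rw [coeff_prod_map_X] at h
    obtain rfl := by_contra fun hm => h (if_neg hm)
    exact (sortedWord_toFinsupp (List.isChain_iff_pairwise.1 hv.1).of_cons).symm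
  · exact absurd (map_zero _) h

lemma sum_coeff_prod_letterMatrix [OrderBot ι] [DecidableEq T] (m : ι →₀ ℕ) (w : List T) :
    ∑ j, coeff m ((w.map (letterMatrix K ℓ)).prod ⊥ j) = if w = sortedWord ℓ m then 1 else 0 := by
  split_ifs with hw
  · subst hw
    have hchain : (⊥ :: m.toMultiset.sort (· ≤ ·)).IsChain (· ≤ ·) :=
      List.isChain_iff_pairwise.2 (List.pairwise_cons.2
        ⟨fun _ _ => bot_le, Multiset.pairwise_sort _ _⟩)
    simp only [sortedWord, prod_letterMatrix_map_apply, hchain, true_and]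
    rw [Fintype.sum_eq_single _ fun j hj => by rw [if_neg hj.symm, map_zero], if_pos rfl,
      coeff_prod_map_X, if_pos (by rw [Multiset.sort_eq, Finsupp.toMultiset_toFinsupp])]
  · exact Finset.sum_eq_zero fun j _ => not_imp_comm.1 eq_sortedWord_of_coeff_ne_zero hw

end LetterMatrix

/-! ### Products of upper triangular matrices -/

section UpperTriangular

variable {ι R : Type*} [Fintype ι] [LinearOrder ι] [CommRing R]

lemma mul_apply_self_of_isUpperTriangular {M N : Matrix ι ι R} (hM : M.IsUpperTriangular)
    (hN : N.IsUpperTriangular) (p : ι) : (M * N) p p = M p p * N p p := by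
  rw [Matrix.mul_apply, Fintype.sum_eq_single p]
  intro k hk
  rcases hk.lt_or_gt with hk | hk
  · rw [hM hk, zero_mul]
  · rw [hN hk, mul_zero]

lemma mul_apply_of_isUpperTriangular {M N : Matrix ι ι R} (hM : M.IsUpperTriangular)
    (hN : N.IsUpperTriangular) {p q : ι} (hpq : p < q) :
    (M * N) p q =
      M p p * N p q + M p q * N q q + ∑ k with p < k ∧ k < q, M p k * N k q := by
  rw [Matrix.mul_apply, ← Finset.sum_pair hpq.ne (f := fun k => M p k * N k q),
    ← Finset.sum_union (Finset.disjoint_left.2 fun k hk hk' => ?_)]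
  · refine (Finset.sum_subset (Finset.subset_univ _) fun k _ hk => ?_).symm
    rcases lt_or_ge k p with hkp | hpk
    · rw [hM hkp, zero_mul]
    · rw [hN, mul_zero]
      grind
  · grind

lemma isUpperTriangular_list_prod {l : List (Matrix ι ι R)} (h : ∀ M ∈ l, M.IsUpperTriangular) :
    l.prod.IsUpperTriangular :=
  list_prod_mem (S := Matrix.blockTriangularSubsemiring R id) h

lemma list_prod_apply_self {l : List (Matrix ι ι R)} (h : ∀ M ∈ l, M.IsUpperTriangular) (p : ι) :
    l.prod p p = (l.map (· p p)).prod := by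
  induction l with
  | nil => exact Matrix.one_apply_eq p
  | cons M l ih =>
    obtain ⟨hM, hl⟩ := List.forall_mem_cons.1 h
    rw [List.prod_cons, List.map_cons, List.prod_cons, ← ih hl,
      mul_apply_self_of_isUpperTriangular hM (isUpperTriangular_list_prod hl)]

variable {S : Type*} [CommRing S] [Algebra S R]

/-- The upper triangular matrices whose entries below row `p` lie in a given subalgebra. -/
def lowerRowsSubmonoid (V : Subalgebra S R) (p : ι) : Submonoid (Matrix ι ι R) where
  carrier := {M | M.IsUpperTriangular ∧ ∀ i j, p < i → M i j ∈ V}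
  one_mem' := by
    refine ⟨Matrix.blockTriangular_one, fun i j _ => ?_⟩
    rw [Matrix.one_apply]
    split_ifs
    exacts [one_mem V, zero_mem V]
  mul_mem' {M N} hM hN := by
    refine ⟨hM.1.mul hN.1, fun i j hi => ?_⟩
    rw [Matrix.mul_apply]
    refine sum_mem fun l _ => ?_
    rcases lt_or_ge l i with hl | hl
    · rw [hM.1 hl, zero_mul]
      exact zero_mem V
    · exact mul_mem (hM.2 i l hi) (hN.2 l j (hi.trans_le hl))

variable {M : Type*} [AddCommGroup M] [Module S M]

lemma map_list_prod_apply {σ : Type*} {V : Subalgebra S R} {π : R →ₗ[S] M}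
    (hπ : ∀ x ∈ V, π x = 0) {p q : ι} (hpq : p < q) {Φ : σ → Matrix ι ι R}
    (hrows : ∀ X, Φ X ∈ lowerRowsSubmonoid V p) (hrow : ∀ X k, p < k → k < q → Φ X p k ∈ V)
    {u v : σ → S} (hu : ∀ X, algebraMap S R (u X) = Φ X p p)
    (hv : ∀ X, algebraMap S R (v X) = Φ X q q) (α : List σ) :
    π ((α.map Φ).prod p q) = leibnizSum u v (fun X => π (Φ X p q)) α := by
  have hprod (α : List σ) : (α.map Φ).prod ∈ lowerRowsSubmonoid V p :=
    list_prod_mem (List.forall_mem_map.2 fun X _ => hrows X)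
  have hlast (α : List σ) : (α.map Φ).prod q q = algebraMap S R (α.map v).prod := by
    rw [list_prod_apply_self (List.forall_mem_map.2 fun X _ => (hrows X).1), List.map_map,
      map_list_prod, List.map_map]
    exact congrArg List.prod (List.map_congr_left fun X _ => (hv X).symm)
  induction α with
  | nil =>
    rw [List.map_nil, List.prod_nil, Matrix.one_apply_ne hpq.ne, map_zero, leibnizSum]
  | cons X α ih =>
    have hmid : ∑ k with p < k ∧ k < q, Φ X p k * (α.map Φ).prod k q ∈ V := by
      refine sum_mem fun k hk => ?_
      obtain ⟨hpk, hkq⟩ := (Finset.mem_filter.1 hk).2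
      exact mul_mem (hrow X k hpk hkq) ((hprod α).2 k q hpk)
    rw [List.map_cons, List.prod_cons, mul_apply_of_isUpperTriangular (hrows X).1 (hprod α).1 hpq,
      map_add, map_add, hπ _ hmid, add_zero, ← hu, hlast, mul_comm (Φ X p q), ← Algebra.smul_def,
      ← Algebra.smul_def, map_smul, map_smul, ih, leibnizSum]

end UpperTriangular

/-! ### The series of a grammar -/

section TreeMatrix

open MvPowerSeries
open scoped MvPowerSeries.WithPiTopology

variable {T : Type*} {g : ContextFreeGrammar T} {ι K : Type*} [Field K] [LinearOrder ι] {ℓ : ι ↪ T}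

lemma letterMatrix_apply_self_mem {B : Subalgebra K (MvPowerSeries ι K)} {p : ι} (hp : X p ∈ B)
    (t : T) : letterMatrix K ℓ t p p ∈ B := by
  classical
  rw [letterMatrix_apply]
  split_ifs
  exacts [hp, zero_mem B]

variable [Fintype ι]

lemma prod_letterMatrix_apply_self (w : List T) (p : ι) :
    (w.map (letterMatrix K ℓ)).prod p p = (w.map fun t => letterMatrix K ℓ t p p).prod := by
  rw [list_prod_apply_self (List.forall_mem_map.2 fun s _ => isUpperTriangular_letterMatrix s),
    List.map_map]
  rfl

lemma constantCoeff_prod_letterMatrix_apply_self (w : List T) (p : ι) :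
    constantCoeff ((w.map (letterMatrix K ℓ)).prod p p) = if w = [] then 1 else 0 := by
  classical
  rw [prod_letterMatrix_apply_self]
  cases w with
  | nil => simp
  | cons t w => simp [letterMatrix_apply, apply_ite]

variable [UniformSpace K]

lemma isTreeSummable_letterMatrix : IsTreeSummable g (letterMatrix K ℓ) := by
  intro X hX
  refine Pi.summable.2 fun i => Pi.summable.2 fun j => ?_
  refine WithPiTopology.summable_iff_summable_coeff.2 fun m => ?_
  exact summable_of_hasFiniteSupport
    ((hX.2 (sortedWord ℓ m)).subset fun t ht => eq_sortedWord_of_coeff_ne_zero ht)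

variable [DiscreteUniformity K]

lemma exists_coeff_ne_zero_of_treeSum {X : Symbol T g.NT} {m : ι →₀ ℕ} {i j : ι}
    (h : coeff m (treeSum (letterMatrix K ℓ) X i j) ≠ 0) :
    ∃ t : g.ParseTree X, coeff m ((t.yield.map (letterMatrix K ℓ)).prod i j) ≠ 0 :=
  isTreeSummable_letterMatrix.exists_map_ne_zero
    (ψ := (coeff m).toAddMonoidHom.comp (Matrix.entryAddMonoidHom _ i j))
    ((WithPiTopology.continuous_coeff K m).comp (continuous_id.matrix_elem i j)) h

lemma isUpperTriangular_treeSum (X : Symbol T g.NT) :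
    (treeSum (letterMatrix K ℓ) X).IsUpperTriangular := by
  intro i j hij
  ext m
  by_contra h
  obtain ⟨t, ht⟩ := exists_coeff_ne_zero_of_treeSum h
  exact ht (by rw [isUpperTriangular_list_prod
    (List.forall_mem_map.2 fun s _ => isUpperTriangular_letterMatrix s) hij, map_zero])

lemma treeSum_apply_self_mem_supportedSub (X : Symbol T g.NT) (p : ι) :
    treeSum (letterMatrix K ℓ) X p p ∈ supportedSub K {p} := by
  intro m hm
  obtain ⟨t, ht⟩ := exists_coeff_ne_zero_of_treeSum hm
  rw [prod_letterMatrix_apply_self] at ht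
  exact list_prod_mem (S := supportedSub K {p}) (List.forall_mem_map.2 fun s _ =>
    letterMatrix_apply_self_mem (X_mem_supportedSub (Set.mem_singleton p)) s) m ht

lemma constantCoeff_treeSum_apply_self {X : Symbol T g.NT} (hX : IsFinitary g X) (p : ι) :
    constantCoeff (treeSum (letterMatrix K ℓ) X p p) =
      ({t : g.ParseTree X | t.yield = []}.ncard : K) :=
  isTreeSummable_letterMatrix.map_treeSum_eq_ncard
    (ψ := constantCoeff.toAddMonoidHom.comp (Matrix.entryAddMonoidHom _ p p))
    ((WithPiTopology.continuous_constantCoeff K).comp (continuous_id.matrix_elem p p)) hX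
    fun w => by classical exact constantCoeff_prod_letterMatrix_apply_self w p

lemma det_one_sub_jacobian_treeSum_ne_zero (p q : ι) :
    (1 - jacobian (fun X : Symbol T g.NT => treeSum (letterMatrix K ℓ) X p p)
      fun X => treeSum (letterMatrix K ℓ) X q q).det ≠ 0 := by
  intro h0
  have hdet := map_det_one_sub_jacobian (g := g) (constantCoeff (σ := ι) (R := K))
    (fun X => treeSum (letterMatrix K ℓ) X p p) fun X => treeSum (letterMatrix K ℓ) X q q
  have hpq : constantCoeff ∘ (fun X : Symbol T g.NT => treeSum (letterMatrix K ℓ) X p p) =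
      constantCoeff ∘ fun X => treeSum (letterMatrix K ℓ) X q q := by
    funext X
    by_cases hX : IsFinitary g X
    · simp only [Function.comp_apply, constantCoeff_treeSum_apply_self hX]
    · simp only [Function.comp_apply, treeSum_of_not_isFinitary _ hX, Matrix.zero_apply]
  rw [h0, map_zero, hpq] at hdet
  refine det_one_sub_jacobian_ne_zero (fun X hX => ?_) hdet.symm
  obtain ⟨t, ht⟩ := exists_coeff_ne_zero_of_treeSum (m := 0) hX
  rw [coeff_zero_eq_constantCoeff_apply] at ht
  classical
  rw [constantCoeff_prod_letterMatrix_apply_self] at ht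
  exact mem_yieldLanguage.2 ⟨t, by_contra fun h => ht (if_neg h)⟩

lemma treeSum_apply_self_mem_algVar (X : Symbol T g.NT) (p : ι) :
    treeSum (letterMatrix K ℓ) X p p ∈ algVar K p := by
  refine ⟨mem_algSub.2 ?_, treeSum_apply_self_mem_supportedSub X p⟩
  refine isAlgebraic_of_det_ne_zero (R := polySub K {p})
    (s := fun X : Symbol T g.NT => treeSum (letterMatrix K ℓ) X p p)
    (fun t => ?_) (fun X hX => ?_) (fun A hA => ?_) (det_one_sub_jacobian_treeSum_ne_zero p p) X
  · rw [isTreeSummable_letterMatrix.treeSum_terminal]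
    have hmem : letterMatrix K ℓ t p p ∈ polySub K {p} :=
      letterMatrix_apply_self_mem (X_mem_polySub (Set.mem_singleton p)) t
    exact ⟨⟨_, hmem⟩, rfl⟩
  · rw [treeSum_of_not_isFinitary _ hX, Matrix.zero_apply]
  · rw [isTreeSummable_letterMatrix.treeSum_nonterminal hA, Matrix.sum_apply]
    refine Finset.sum_congr rfl fun r _ => ?_
    rw [list_prod_apply_self (List.forall_mem_map.2 fun X _ => isUpperTriangular_treeSum X),
      List.map_map]
    rfl

lemma treeSum_apply_mem_pairFractions_of_lt {p q : ι} (hpq : p < q)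
    (hrows : ∀ (X : Symbol T g.NT) i j, p < i → treeSum (letterMatrix K ℓ) X i j ∈
      pairFractions ι K)
    (hrow : ∀ (X : Symbol T g.NT) k, p < k → k < q → treeSum (letterMatrix K ℓ) X p k ∈
      pairFractions ι K) (X : Symbol T g.NT) :
    treeSum (letterMatrix K ℓ) X p q ∈ pairFractions ι K := by
  classical
  let Φ (X : Symbol T g.NT) := treeSum (letterMatrix K ℓ) X
  let S := algTensor K ({p, q} : Set ι)
  let V : Subalgebra S (MvPowerSeries ι K) :=
    { pairFractions ι K with algebraMap_mem' := fun s => algTensor_le_pairFractions _ s.2 }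
  let u (X : Symbol T g.NT) : S :=
    ⟨Φ X p p, algVar_le_algTensor (by simp) (treeSum_apply_self_mem_algVar X p)⟩
  let v (X : Symbol T g.NT) : S :=
    ⟨Φ X q q, algVar_le_algTensor (by simp) (treeSum_apply_self_mem_algVar X q)⟩
  let π := V.toSubmodule.mkQ
  have hπ {x} : π x = 0 ↔ x ∈ pairFractions ι K := Submodule.Quotient.mk_eq_zero _
  have hterminal (t : T) : Φ (.terminal t) p q ∈ pairFractions ι K := by
    simp only [Φ, isTreeSummable_letterMatrix.treeSum_terminal, letterMatrix_apply]
    split_ifs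
    · exact algTensor_le_pairFractions Set.univ (polySub_le_algTensor _ (X_mem_polySub trivial))
    · exact zero_mem _
  have hsum (A : g.NT) (hA : IsFinitary g (.nonterminal A)) : π (Φ (.nonterminal A) p q) =
      ∑ r ∈ finitaryRules g A, leibnizSum u v (fun X => π (Φ X p q)) r.output := by
    simp only [Φ, isTreeSummable_letterMatrix.treeSum_nonterminal hA, Matrix.sum_apply, map_sum]
    exact Finset.sum_congr rfl fun r _ => map_list_prod_apply (V := V) (fun x hx => hπ.2 hx) hpq
      (fun X => ⟨isUpperTriangular_treeSum X, hrows X⟩) hrow (fun _ => rfl) (fun _ => rfl) r.output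
  rcases X with t | A
  · exact hterminal t
  by_cases hA : IsFinitary g (.nonterminal A)
  · have hdet : ((1 - jacobian u v).det : MvPowerSeries ι K) ≠ 0 := by
      have hmap := map_det_one_sub_jacobian (algebraMap S (MvPowerSeries ι K)) u v
      exact fun h => det_one_sub_jacobian_treeSum_ne_zero p q (hmap.symm.trans h)
    refine mem_pairFractions_of_mul_mem (1 - jacobian u v).det.2 hdet (hπ.1 ?_)
    exact det_one_sub_jacobian_smul_eq_zero (d := fun X => π (Φ X p q))
      (fun t => hπ.2 (hterminal t)) hsum ⟨A, hA⟩
  · rw [treeSum_of_not_isFinitary _ hA]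
    exact zero_mem _

theorem treeSum_apply_mem_pairFractions (X : Symbol T g.NT) (p q : ι) :
    treeSum (letterMatrix K ℓ) X p q ∈ pairFractions ι K := by
  induction p using WellFoundedGT.induction generalizing X q with | ind p hrows =>
  induction q using WellFoundedLT.induction generalizing X with | ind q hrow =>
  rcases lt_trichotomy p q with hpq | rfl | hqp
  · exact treeSum_apply_mem_pairFractions_of_lt hpq (fun X i j hi => hrows i hi X j)
      (fun X k _ hk => hrow k hk X) X
  · exact algTensor_le_pairFractions {p}
      (algVar_le_algTensor (Set.mem_singleton p) (treeSum_apply_self_mem_algVar X p))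
  · rw [isUpperTriangular_treeSum X hqp]
    exact zero_mem _

end TreeMatrix

/-- The generating series of the numbers of parse trees of the words `sortedWord ℓ m`. -/
noncomputable def countSeries {T ι : Type*} [LinearOrder ι] (K : Type*) [Semiring K] (ℓ : ι ↪ T)
    {g : ContextFreeGrammar T} (X : Symbol T g.NT) : MvPowerSeries ι K :=
  fun m => ({t : g.ParseTree X | t.yield = sortedWord ℓ m}.ncard : K)

theorem countSeries_mem_pairFractions {T ι : Type*} [Finite ι] [LinearOrder ι] [OrderBot ι]
    (K : Type*) [Field K] (ℓ : ι ↪ T) {g : ContextFreeGrammar T} {X : Symbol T g.NT}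
    (hX : IsFinitary g X) : countSeries K ℓ X ∈ pairFractions ι K := by
  open scoped MvPowerSeries.WithPiTopology in
  let _ : UniformSpace K := ⊥
  cases nonempty_fintype ι
  have hcount : countSeries K ℓ X = ∑ j, treeSum (letterMatrix K ℓ) X ⊥ j := by
    ext m
    let ψ : Matrix ι ι (MvPowerSeries ι K) →+ K :=
      ∑ j, (MvPowerSeries.coeff m).toAddMonoidHom.comp (Matrix.entryAddMonoidHom _ ⊥ j)
    have hψ (M) : ψ M = ∑ j, MvPowerSeries.coeff m (M ⊥ j) := by
      simp [ψ]
    have hcont : Continuous ψ := by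
      simp only [funext hψ]
      exact continuous_finsetSum _ fun j _ =>
        (MvPowerSeries.WithPiTopology.continuous_coeff K m).comp (continuous_id.matrix_elem ⊥ j)
    rw [map_sum, ← hψ, isTreeSummable_letterMatrix.map_treeSum_eq_ncard (w₀ := sortedWord ℓ m)
      hcont hX fun w => by classical exact (hψ _).trans (sum_coeff_prod_letterMatrix m w)]
    rfl
  rw [hcount]
  exact sum_mem fun j _ => treeSum_apply_mem_pairFractions X ⊥ j

/-! ### The diagonal series -/

section Slices

open MvPowerSeries

variable {ι K : Type*} [Field K] {i : ι}

/-- The coefficient of the `n`-th power of the variable `i`, a power series in the other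
variables. -/
noncomputable def slice (i : ι) (n : ℕ) : MvPowerSeries ι K →ₗ[K] MvPowerSeries ι K :=
  LinearMap.pi fun m => if m i = 0 then coeff (m + Finsupp.single i n) else 0

lemma coeff_slice (n : ℕ) (f : MvPowerSeries ι K) (m : ι →₀ ℕ) :
    coeff m (slice i n f) = if m i = 0 then coeff (m + Finsupp.single i n) f else 0 := by
  change (if m i = 0 then coeff (m + Finsupp.single i n) else 0 : _ →ₗ[K] K) f = _
  split_ifs <;> rfl

lemma apply_eq_zero_of_coeff_ne_zero {f : MvPowerSeries ι K} (hf : f ∈ supportedSub K {i}ᶜ)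
    {m : ι →₀ ℕ} (hm : coeff m f ≠ 0) : m i = 0 :=
  Finsupp.notMem_support_iff.1 fun hi => hf m hm hi rfl

lemma slice_mul_left {t : MvPowerSeries ι K} (ht : t ∈ supportedSub K {i}ᶜ) (n : ℕ)
    (f : MvPowerSeries ι K) : slice i n (t * f) = t * slice i n f := by
  classical
  ext m
  simp only [coeff_slice, coeff_mul, mul_ite, mul_zero]
  split_ifs with hm
  · refine (Finset.sum_of_injOn (fun p => (p.1, p.2 + Finsupp.single i n)) ?_ ?_ ?_ ?_).symm
    · exact fun p _ q _ h => Prod.ext (Prod.ext_iff.1 h).1 (add_right_cancel (Prod.ext_iff.1 h).2)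
    · intro p hp
      rw [Finset.mem_coe, Finset.HasAntidiagonal.mem_antidiagonal] at hp ⊢
      rw [← add_assoc, hp]
    · intro p hp hp'
      by_contra h
      have hp1 := apply_eq_zero_of_coeff_ne_zero ht (left_ne_zero_of_mul h)
      rw [Finset.HasAntidiagonal.mem_antidiagonal] at hp
      have hle : Finsupp.single i n ≤ p.2 := by
        have hi := DFunLike.congr_fun hp i
        rw [Finsupp.add_apply, Finsupp.add_apply, hp1, hm, Finsupp.single_eq_same] at hi
        exact Finsupp.single_le_iff.2 (by lia)
      refine hp' ⟨(p.1, p.2 - Finsupp.single i n), ?_, ?_⟩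
      · rw [Finset.mem_coe, Finset.HasAntidiagonal.mem_antidiagonal, ← add_tsub_assoc_of_le hle, hp,
          add_tsub_cancel_right]
      · exact Prod.ext rfl (tsub_add_cancel_of_le hle)
    · intro p hp
      rw [Finset.HasAntidiagonal.mem_antidiagonal] at hp
      rw [if_pos]
      have hi := DFunLike.congr_fun hp i
      rw [Finsupp.add_apply, hm] at hi
      lia
  · refine (Finset.sum_eq_zero fun p hp => ?_).symm
    by_contra h
    obtain ⟨hp2, h⟩ := ite_ne_right_iff.1 h
    refine hm ?_
    rw [← Finset.HasAntidiagonal.mem_antidiagonal.1 hp, Finsupp.add_apply, hp2,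
      apply_eq_zero_of_coeff_ne_zero ht (left_ne_zero_of_mul h)]

lemma slice_X_mul (n : ℕ) (f : MvPowerSeries ι K) : slice i (n + 1) (X i * f) = slice i n f := by
  ext m
  rw [coeff_slice, coeff_slice, Finsupp.single_add, ← add_assoc, add_comm _ (Finsupp.single i 1),
    X, coeff_add_monomial_mul, one_mul]

lemma slice_mul {a b : MvPowerSeries ι K} (ha : a ∈ supportedSub K {i})
    (hb : b ∈ supportedSub K {i}ᶜ) (n : ℕ) :
    slice i n (a * b) = coeff (Finsupp.single i n) a • b := by
  classical
  have hslice : slice i n a = algebraMap K _ (coeff (Finsupp.single i n) a) := by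
    ext m
    rw [coeff_slice, MvPowerSeries.algebraMap_apply, coeff_C, Algebra.algebraMap_self,
      RingHom.id_apply]
    split_ifs with hi h0 h0
    · rw [h0, zero_add]
    · by_contra hm
      obtain ⟨j, hj⟩ := DFunLike.ne_iff.1 h0
      have hji := ha _ hm (a := j) (Finsupp.mem_support_iff.2 (by simp_all))
      exact hj (hji ▸ hi)
    · exact absurd (DFunLike.congr_fun h0 i) hi
    · rfl
  rw [mul_comm, slice_mul_left hb, hslice, Algebra.smul_def, mul_comm]

lemma exists_finiteDimensional_forall_slice_mem {f : MvPowerSeries ι K}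
    (hf : f ∈ algTensor K Set.univ) (i : ι) :
    ∃ W : Submodule K (MvPowerSeries ι K), FiniteDimensional K W ∧ ∀ n, slice i n f ∈ W := by
  have hle : algTensor K Set.univ ≤ supportedSub K {i} ⊔ supportedSub K {i}ᶜ := by
    refine iSup₂_le fun j _ => inf_le_right.trans ?_
    rcases eq_or_ne j i with rfl | hj
    · exact le_sup_left
    · exact (supportedSub_mono (Set.singleton_subset_iff.2 hj)).trans le_sup_right
  have hmem := hle hf
  clear hf
  rw [← Subalgebra.mem_toSubmodule, ← Subalgebra.mul_toSubmodule] at hmem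
  induction hmem using Submodule.mul_induction_on' with
  | mem_mul_mem a ha b hb =>
    refine ⟨Submodule.span K {b}, inferInstance, fun n => ?_⟩
    rw [slice_mul ha hb]
    exact Submodule.smul_mem _ _ (Submodule.mem_span_singleton_self b)
  | add x _ y _ hx hy =>
    obtain ⟨W, _, hW⟩ := hx
    obtain ⟨W', _, hW'⟩ := hy
    refine ⟨W ⊔ W', inferInstance, fun n => ?_⟩
    rw [map_add]
    exact add_mem (Submodule.mem_sup_left (hW n)) (Submodule.mem_sup_right (hW' n))

lemma transcendental_of_constantCoeff_eq_zero {t : MvPowerSeries ι K} (h0 : t ≠ 0)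
    (ht : constantCoeff t = 0) : Transcendental K t := by
  intro halg
  obtain ⟨y, -, c, hc, h⟩ :=
    halg.exists_nonzero_eq_adjoin_mul (mem_nonZeroDivisors_of_ne_zero h0)
  refine hc ?_
  simpa only [map_mul, ht, zero_mul, MvPowerSeries.algebraMap_apply, constantCoeff_C,
    Algebra.algebraMap_self, RingHom.id_apply] using (congrArg constantCoeff h).symm

lemma eq_zero_of_forall_pow_mul_mem {t f : MvPowerSeries ι K} (h0 : t ≠ 0)
    (ht : constantCoeff t = 0) {W : Submodule K (MvPowerSeries ι K)} [FiniteDimensional K W]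
    (hW : ∀ n, t ^ n * f ∈ W) : f = 0 := by
  by_contra hf
  let L : Polynomial K →ₗ[K] MvPowerSeries ι K :=
    (LinearMap.mulRight K f).comp (Polynomial.aeval t).toLinearMap
  have hL (P : Polynomial K) : L P ∈ W := by
    induction P using Polynomial.induction_on' with
    | add P Q hP hQ => rw [map_add]; exact add_mem hP hQ
    | monomial n r =>
      have : L (Polynomial.monomial n r) = r • (t ^ n * f) := by
        simp [L, Polynomial.aeval_monomial, Algebra.smul_def, mul_assoc]
      exact this ▸ W.smul_mem r (hW n)
  have hinj : Function.Injective L := fun P Q h =>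
    transcendental_iff_injective.1 (transcendental_of_constantCoeff_eq_zero h0 ht)
      (mul_right_cancel₀ hf h)
  exact Polynomial.not_finite (Module.Finite.of_injective (L.codRestrict W hL)
    fun P Q h => hinj (congrArg Subtype.val h))

lemma slice_coe_eventually_eq_zero (i : ι) (p : MvPolynomial ι K) :
    ∀ᶠ n in Filter.atTop, slice i n (p : MvPowerSeries ι K) = 0 := by
  filter_upwards [Filter.eventually_gt_atTop (p.degreeOf i)] with n hn
  ext m
  rw [coeff_slice, MvPolynomial.coeff_coe, map_zero, ite_eq_right_iff]
  refine fun _ => MvPolynomial.notMem_support_iff.1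
    (MvPolynomial.notMem_support_of_degreeOf_lt i (hn.trans_le ?_))
  rw [Finsupp.add_apply, Finsupp.single_eq_same]
  exact Nat.le_add_left n (m i)

lemma slice_eventually_eq_zero {f : MvPowerSeries ι K} (hf : f ∈ algTensor K Set.univ)
    {t : MvPowerSeries ι K} (ht : t ∈ supportedSub K {i}ᶜ) (h0 : t ≠ 0)
    (hct : constantCoeff t = 0) {p : MvPolynomial ι K}
    (h : (p : MvPowerSeries ι K) = (1 - X i * t) * f) :
    ∀ᶠ n in Filter.atTop, slice i n f = 0 := by
  obtain ⟨W, _, hW⟩ := exists_finiteDimensional_forall_slice_mem hf i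
  obtain ⟨N, hN⟩ := Filter.eventually_atTop.1 (slice_coe_eventually_eq_zero i p)
  have hsucc (n) (hn : N ≤ n) : slice i (n + 1) f = t * slice i n f := by
    have hslice := hN (n + 1) (hn.trans n.le_succ)
    rwa [h, sub_mul, one_mul, map_sub, mul_assoc, slice_X_mul, slice_mul_left ht,
      sub_eq_zero] at hslice
  have hpow (k) : slice i (N + k) f = t ^ k * slice i N f := by
    induction k with
    | zero => rw [pow_zero, one_mul, add_zero]
    | succ k ih => rw [← add_assoc, hsucc _ (N.le_add_right k), ih, pow_succ', mul_assoc]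
  have hzero : slice i N f = 0 :=
    eq_zero_of_forall_pow_mul_mem h0 hct fun k => hpow k ▸ hW (N + k)
  refine Filter.eventually_atTop.2 ⟨N, fun n hn => ?_⟩
  rw [← Nat.add_sub_of_le hn, hpow, hzero, mul_zero]

lemma exists_coe_eq_of_slice_eventually_eq_zero [Finite ι] {f : MvPowerSeries ι K}
    (hf : ∀ i, ∀ᶠ n in Filter.atTop, slice i n f = 0) : ∃ q : MvPolynomial ι K, ↑q = f := by
  classical
  choose N hN using fun i => Filter.eventually_atTop.1 (hf i)
  refine ⟨trunc' K (Finsupp.equivFunOnFinite.symm N) f, ?_⟩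
  ext m
  rw [MvPolynomial.coeff_coe, coeff_trunc']
  refine ite_eq_left_iff.2 fun hm => ?_
  obtain ⟨i, hi⟩ := not_forall.1 hm
  have := congrArg (coeff (m.erase i)) (hN i (m i) (not_le.1 hi).le)
  rw [coeff_slice, if_pos Finsupp.erase_same, Finsupp.erase_add_single, map_zero] at this
  exact this.symm

variable [Fintype ι]

lemma exists_coe_eq_of_one_sub_prod_X_mul_eq_coe [Nontrivial ι]
    {f : MvPowerSeries ι K} (hf : f ∈ algTensor K Set.univ) {p : MvPolynomial ι K}
    (h : (p : MvPowerSeries ι K) = (1 - ∏ i, X i) * f) : ∃ q : MvPolynomial ι K, ↑q = f := by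
  classical
  refine exists_coe_eq_of_slice_eventually_eq_zero fun i => ?_
  obtain ⟨j, hj⟩ := exists_ne i
  refine slice_eventually_eq_zero hf (t := ∏ j ∈ Finset.univ.erase i, X j)
    (prod_mem fun k hk => X_mem_supportedSub (Finset.ne_of_mem_erase hk))
    (Finset.prod_ne_zero_iff.2 fun k _ => ?_) ?_ (p := p) ?_
  · rw [← MvPolynomial.coe_X, Ne, MvPolynomial.coe_eq_zero_iff]
    exact MvPolynomial.X_ne_zero k
  · rw [map_prod, Finset.prod_eq_zero (Finset.mem_erase.2 ⟨hj, Finset.mem_univ j⟩)]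
    exact constantCoeff_X j
  · rw [Finset.mul_prod_erase _ _ (Finset.mem_univ i), h]

end Slices

section Diagonal

variable {ι K : Type*} [Field K] [Fintype ι]

lemma irreducible_one_sub_prod_X [Nonempty ι] :
    Irreducible (1 - ∏ i, MvPolynomial.X i : MvPolynomial ι K) := by
  classical
  obtain ⟨i⟩ := ‹Nonempty ι›
  have hvars : i ∉ (-∏ j ∈ Finset.univ.erase i, MvPolynomial.X j : MvPolynomial ι K).vars := by
    rw [MvPolynomial.vars_neg]
    intro hi
    obtain ⟨j, hj, hij⟩ := Finset.mem_biUnion.1 (MvPolynomial.vars_prod _ hi)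
    rw [MvPolynomial.vars_X, Finset.mem_singleton] at hij
    exact Finset.ne_of_mem_erase hj hij.symm
  rw [← Finset.prod_erase_mul _ _ (Finset.mem_univ i), sub_eq_neg_add, ← neg_mul]
  refine MvPolynomial.irreducible_mul_X_add _ _ i
    (neg_ne_zero.2 (Finset.prod_ne_zero_iff.2 fun j _ => MvPolynomial.X_ne_zero j)) hvars
    (by rw [MvPolynomial.vars_one]; exact Finset.notMem_empty i) isRelPrime_one_right

lemma not_one_sub_prod_X_dvd {p : MvPolynomial ι K} (hp : p ≠ 0) {k : ι} (hk : k ∉ p.vars) :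
    ¬ (1 - ∏ i, MvPolynomial.X i) ∣ p := by
  classical
  rintro ⟨q, rfl⟩
  have hprod : (-∏ i, MvPolynomial.X i : MvPolynomial ι K).degreeOf k = 1 := by
    rw [MvPolynomial.degreeOf_neg,
      MvPolynomial.degreeOf_prod_eq _ _ fun i _ => MvPolynomial.X_ne_zero i]
    simp [MvPolynomial.degreeOf_X]
  have hdeg : ((1 - ∏ i, MvPolynomial.X i) * q : MvPolynomial ι K).degreeOf k = 0 := by
    rwa [MvPolynomial.degreeOf_def, Multiset.count_eq_zero, ← Multiset.mem_toFinset,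
      ← MvPolynomial.vars_def]
  rw [MvPolynomial.degreeOf_mul_eq (left_ne_zero_of_mul hp) (right_ne_zero_of_mul hp),
    sub_eq_neg_add, MvPolynomial.degreeOf_add_eq_of_degreeOf_lt (by simp [hprod]), hprod] at hdeg
  lia

lemma exists_coe_eq_of_mem_pairDenominators (hι : 2 < Fintype.card ι) {x : MvPowerSeries ι K}
    (hx : x ∈ pairDenominators ι K) :
    ∃ p : MvPolynomial ι K, ↑p = x ∧ ¬ (1 - ∏ i, MvPolynomial.X i) ∣ p := by
  classical
  have : Nonempty ι := Fintype.card_pos_iff.1 (pos_of_gt hι)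
  have hprime := (irreducible_one_sub_prod_X (ι := ι) (K := K)).prime
  let S : Submonoid (MvPowerSeries ι K) :=
    { carrier := {x | ∃ p : MvPolynomial ι K, ↑p = x ∧ ¬ (1 - ∏ i, MvPolynomial.X i) ∣ p}
      one_mem' := ⟨1, MvPolynomial.coe_one, fun h => hprime.not_isUnit (isUnit_of_dvd_one h)⟩
      mul_mem' := by
        rintro _ _ ⟨p, rfl, hp⟩ ⟨q, rfl, hq⟩
        exact ⟨p * q, MvPolynomial.coe_mul p q, hprime.not_dvd_mul hp hq⟩ }
  have hle : pairDenominators ι K ≤ S := by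
    refine iSup₂_le fun i j x ⟨hx, h0⟩ => ?_
    obtain ⟨p, hp, rfl⟩ := mem_polySub.1 hx
    obtain ⟨k, hk⟩ : ∃ k, k ∉ ({i, j} : Finset ι) := by
      by_contra! h
      exact hι.not_ge ((Finset.card_le_card fun k _ => h k).trans Finset.card_le_two)
    have hvars := MvPolynomial.mem_supported.1 hp
    exact ⟨p, rfl, not_one_sub_prod_X_dvd
      (fun h => nonZeroDivisors.ne_zero h0 (by rw [h, MvPolynomial.coe_zero]))
      fun h => hk (by simpa using hvars h)⟩
  exact hle hx

theorem notMem_pairFractions_of_one_sub_prod_X_mul_eq_one (hι : 2 < Fintype.card ι)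
    {f : MvPowerSeries ι K} (hf : (1 - ∏ i, MvPowerSeries.X i) * f = 1) :
    f ∉ pairFractions ι K := by
  have : Nontrivial ι := Fintype.one_lt_card_iff_nontrivial.1 (by lia)
  rintro ⟨x, hx, hxf⟩
  obtain ⟨p, rfl, hp⟩ := exists_coe_eq_of_mem_pairDenominators hι hx
  obtain ⟨q, hq⟩ := exists_coe_eq_of_one_sub_prod_X_mul_eq_coe hxf (p := p)
    (by rw [mul_left_comm, hf, mul_one])
  refine hp ⟨q, MvPolynomial.coe_injective _ _ ?_⟩
  have hcoe : ((1 - ∏ i, MvPolynomial.X i : MvPolynomial ι K) : MvPowerSeries ι K) =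
      1 - ∏ i, MvPowerSeries.X i := by
    rw [← MvPolynomial.coeToMvPowerSeries.ringHom_apply, map_sub, map_one, map_prod]
    simp only [MvPolynomial.coeToMvPowerSeries.ringHom_apply, MvPolynomial.coe_X]
  rw [MvPolynomial.coe_mul, hq, hcoe, mul_left_comm, hf, mul_one]

end Diagonal

/-! ### The language `{aⁿ bᵐ cˡ | n = m or m = l}` -/

section Indicator

open MvPowerSeries

variable {ι R : Type*}

/-- The generating series of a set of monomials: the sum of the monomials that satisfy `P`. -/
noncomputable def indicator (R : Type*) [Semiring R] (P : (ι →₀ ℕ) → Prop) : MvPowerSeries ι R :=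
  open Classical in fun m => if P m then 1 else 0

lemma coeff_indicator [Semiring R] (P : (ι →₀ ℕ) → Prop) [DecidablePred P] (m : ι →₀ ℕ) :
    coeff m (indicator R P) = if P m then 1 else 0 := by
  change @ite _ (P m) (Classical.propDecidable _) 1 0 = _
  congr

lemma indicator_or_add_indicator_and [Semiring R] (P Q : (ι →₀ ℕ) → Prop) :
    indicator R (fun m => P m ∨ Q m) + indicator R (fun m => P m ∧ Q m) =
      indicator R P + indicator R Q := by
  classical
  ext m
  simp only [map_add, coeff_indicator]
  by_cases hP : P m <;> by_cases hQ : Q m <;> simp [hP, hQ]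

lemma indicator_eq_one [Semiring R] {P : (ι →₀ ℕ) → Prop} (hP : ∀ m, P m ↔ m = 0) :
    indicator R P = 1 := by
  classical
  ext m
  rw [coeff_indicator, coeff_one, if_congr (hP m) rfl rfl]

lemma one_sub_monomial_mul_indicator [Ring R] {P : (ι →₀ ℕ) → Prop} {d : ι →₀ ℕ}
    (hP : ∀ m, P (m + d) ↔ P m) :
    (1 - monomial d 1) * indicator R P = indicator R fun m => P m ∧ ¬ d ≤ m := by
  classical
  ext m
  rw [sub_mul, one_mul, map_sub, coeff_monomial_mul, one_mul]
  by_cases hd : d ≤ m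
  · rw [if_pos hd, coeff_indicator, coeff_indicator, coeff_indicator, ← hP (m - d),
      tsub_add_cancel_of_le hd, sub_self, if_neg fun h => h.2 hd]
  · rw [if_neg hd, sub_zero, coeff_indicator, coeff_indicator, if_congr (and_iff_left hd) rfl rfl]

lemma prod_X_eq_monomial [CommSemiring R] [Fintype ι] :
    (∏ i, X i : MvPowerSeries ι R) = monomial (Finsupp.equivFunOnFinite.symm 1) 1 := by
  classical
  simp only [X, prod_monomial, Finset.prod_const_one, Finsupp.equivFunOnFinite_symm_eq_sum,
    Pi.one_apply]

lemma one_sub_prod_X_mul_indicator [CommRing R] [Fintype ι] (i₀ : ι) :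
    (1 - ∏ i, X i) * indicator R (fun m : ι →₀ ℕ => ∀ i, m i = m i₀) = 1 := by
  rw [prod_X_eq_monomial, one_sub_monomial_mul_indicator]
  · refine indicator_eq_one fun m => ?_
    simp only [Finsupp.le_def, Finsupp.ext_iff, Finsupp.equivFunOnFinite_symm_apply_apply,
      Pi.one_apply, not_forall, Finsupp.coe_zero, Pi.zero_apply]
    constructor
    · rintro ⟨h, i, hi⟩ j
      rw [h j, ← h i]
      lia
    · exact fun h => ⟨fun i => by rw [h, h], i₀, by rw [h]; exact Nat.one_pos.not_ge⟩
  · exact fun m => by simp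

variable {K : Type*} [Field K] {i j k : ι}

lemma one_sub_X_mul_indicator [CommRing R] (hij : i ≠ j) (hik : i ≠ k) (hjk : j ≠ k)
    (h : ∀ l, l = i ∨ l = j ∨ l = k) :
    (1 - X k) * ((1 - X i * X j) * indicator R (fun m : ι →₀ ℕ => m i = m j)) = 1 := by
  have hforall {p : ι → Prop} : (∀ l, p l) ↔ p i ∧ p j ∧ p k := by
    refine ⟨fun hp => ⟨hp i, hp j, hp k⟩, fun hp l => ?_⟩
    rcases h l with rfl | rfl | rfl
    exacts [hp.1, hp.2.1, hp.2.2]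
  rw [X, X, X, monomial_mul_monomial, mul_one, one_sub_monomial_mul_indicator,
    one_sub_monomial_mul_indicator]
  · refine indicator_eq_one fun m => ?_
    simp only [Finsupp.le_def, Finsupp.add_apply, hforall, Finsupp.single_eq_same, ne_eq, hij,
      not_false_eq_true, Finsupp.single_eq_of_ne, hij.symm, hik.symm, hjk.symm, hik, hjk,
      DFunLike.ext_iff, Finsupp.zero_apply]
    lia
  · intro m
    simp [Finsupp.le_def, hforall, hij, hij.symm, hik, hik.symm, hjk, hjk.symm]
  · intro m
    simp [hij, hij.symm]

lemma indicator_eq_mem_pairFractions (hij : i ≠ j) (hik : i ≠ k) (hjk : j ≠ k)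
    (h : ∀ l, l = i ∨ l = j ∨ l = k) :
    indicator K (fun m : ι →₀ ℕ => m i = m j) ∈ pairFractions ι K := by
  have hone := one_sub_X_mul_indicator (R := K) hij hik hjk h
  have hX (l : ι) (σ : Set ι) (hl : l ∈ σ) : (X l : MvPowerSeries ι K) ∈ algTensor K σ :=
    polySub_le_algTensor σ (X_mem_polySub hl)
  refine mem_pairFractions_of_mul_mem (i := i) (j := j)
    (sub_mem (one_mem _) (mul_mem (hX i _ (by simp)) (hX j _ (by simp)))) (fun h0 => ?_) <|
    mem_pairFractions_of_mul_mem (i := k) (j := k) (sub_mem (one_mem _) (hX k _ (by simp)))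
      (left_ne_zero_of_mul_eq_one hone) (by rw [hone]; exact one_mem _)
  rw [h0, zero_mul, mul_zero] at hone
  exact zero_ne_one hone

theorem indicator_someEqual_notMem_pairFractions :
    indicator K (fun m : Fin 3 →₀ ℕ => m 0 = m 1 ∨ m 1 = m 2) ∉ pairFractions (Fin 3) K := by
  intro h
  refine notMem_pairFractions_of_one_sub_prod_X_mul_eq_one (by simp)
    (one_sub_prod_X_mul_indicator (R := K) (1 : Fin 3)) ?_
  have hall : (fun m : Fin 3 →₀ ℕ => ∀ i, m i = m 1) = fun m => m 0 = m 1 ∧ m 1 = m 2 := by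
    funext m
    simp only [Fin.forall_fin_succ, Fin.succ_zero_eq_one, Fin.succ_one_eq_two,
      IsEmpty.forall_iff, eq_iff_iff]
    lia
  rw [hall, ← add_sub_cancel_left (indicator K _) (indicator K fun m : Fin 3 →₀ ℕ => _ ∧ _),
    indicator_or_add_indicator_and]
  exact sub_mem (add_mem (indicator_eq_mem_pairFractions (k := 2) (by decide) (by decide)
    (by decide) (by decide)) (indicator_eq_mem_pairFractions (k := 0) (by decide) (by decide)
    (by decide) (by decide))) h

end Indicator

section SomeEqual

variable {T : Type*} {a b c : T}

lemma sortedWord_fin_three (ℓ : Fin 3 ↪ T) (m : Fin 3 →₀ ℕ) :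
    sortedWord ℓ m =
      List.replicate (m 0) (ℓ 0) ++ List.replicate (m 1) (ℓ 1) ++ List.replicate (m 2) (ℓ 2) := by
  let v : List (Fin 3) := List.replicate (m 0) 0 ++ List.replicate (m 1) 1 ++ List.replicate (m 2) 2
  have hsorted : v.Pairwise (· ≤ ·) := by
    simp only [v, List.pairwise_append, List.pairwise_replicate, List.mem_append,
      List.mem_replicate]
    lia
  have hcount : (v : Multiset (Fin 3)).toFinsupp = m := by
    ext i
    fin_cases i <;> simp [v, List.count_replicate]
  have hword := sortedWord_toFinsupp (ℓ := ℓ) hsorted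
  rw [hcount] at hword
  simpa only [v, List.map_append, List.map_replicate] using hword

lemma append_replicate_mem_someEqualLanguage_iff (hab : a ≠ b) (hac : a ≠ c) (hbc : b ≠ c)
    (n m l : ℕ) :
    List.replicate n a ++ List.replicate m b ++ List.replicate l c ∈ someEqualLanguage a b c ↔
      n = m ∨ m = l := by
  classical
  refine ⟨?_, fun h => ⟨n, m, l, h, rfl⟩⟩
  rintro ⟨n', m', l', h, hw⟩
  have ha := congrArg (List.count a) hw
  have hb := congrArg (List.count b) hw
  have hc := congrArg (List.count c) hw
  simp only [List.count_append, List.count_replicate_self, List.count_replicate, beq_iff_eq, hab,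
    hac, hbc, hab.symm, hac.symm, hbc.symm, if_false, zero_add, add_zero] at ha hb hc
  lia

theorem gf2Grammar_language_ne_someEqualLanguage (hab : a ≠ b) (hac : a ≠ c) (hbc : b ≠ c)
    (G : GF2Grammar T) : G.language ≠ someEqualLanguage a b c := by
  classical
  intro hG
  have hodd (w : List T) : w ∈ someEqualLanguage a b c ↔ Odd (G.parseTrees G.initial w).ncard :=
    hG ▸ Iff.rfl
  have hfinitary : IsFinitary G.toContextFreeGrammar (.nonterminal G.initial) := by
    have hnil : ([] : List T) ∈ someEqualLanguage a b c := ⟨0, 0, 0, .inl rfl, rfl⟩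
    obtain ⟨t, -⟩ := Set.nonempty_of_ncard_ne_zero ((hodd []).1 hnil).pos.ne'
    exact ⟨⟨t⟩, G.wellFormed⟩
  let ℓ : Fin 3 ↪ T := ⟨![a, b, c], by
    intro i j hij
    fin_cases i <;> fin_cases j <;> simp_all⟩
  have hseries : countSeries (ZMod 2) ℓ (.nonterminal G.initial : Symbol T G.NT) =
      indicator (ZMod 2) fun m => m 0 = m 1 ∨ m 1 = m 2 := by
    ext m
    have hmem := (hodd _).symm.trans
      (append_replicate_mem_someEqualLanguage_iff hab hac hbc (m 0) (m 1) (m 2))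
    rw [coeff_indicator, if_congr hmem.symm rfl rfl]
    change ((G.parseTrees G.initial (sortedWord ℓ m)).ncard : ZMod 2) = _
    rw [sortedWord_fin_three]
    split_ifs with h
    · exact ZMod.natCast_eq_one_iff_odd.2 h
    · exact ZMod.natCast_eq_zero_iff_even.2 (Nat.not_odd_iff_even.1 h)
  exact indicator_someEqual_notMem_pairFractions
    (hseries ▸ countSeries_mem_pairFractions (ZMod 2) ℓ hfinitary)

/-- The nonterminals of `someEqualGrammar`. -/
inductive SomeEqualNT : Type
  | start | leftEqual | rightEqual | first | last

open SomeEqualNT Symbol in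
/-- The rules of `someEqualGrammar`. -/
def someEqualRules (a b c : T) : List (ContextFreeRule T SomeEqualNT) :=
  [⟨start, [nonterminal leftEqual, nonterminal last]⟩,
    ⟨start, [nonterminal first, nonterminal rightEqual]⟩,
    ⟨leftEqual, [terminal a, nonterminal leftEqual, terminal b]⟩, ⟨leftEqual, []⟩,
    ⟨rightEqual, [terminal b, nonterminal rightEqual, terminal c]⟩, ⟨rightEqual, []⟩,
    ⟨first, [terminal a, nonterminal first]⟩, ⟨first, []⟩,
    ⟨last, [terminal c, nonterminal last]⟩, ⟨last, []⟩]

/-- A grammar for the language `{aⁿ bᵐ cˡ | n = m or m = l}`. -/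
noncomputable def someEqualGrammar (a b c : T) : ContextFreeGrammar T where
  NT := SomeEqualNT
  initial := .start
  rules := open Classical in (someEqualRules a b c).toFinset

/-- The languages of the symbols of `someEqualGrammar`. -/
def someEqualSymbolLanguage (a b c : T) : Symbol T SomeEqualNT → Language T
  | .terminal t => {[t]}
  | .nonterminal .start => someEqualLanguage a b c
  | .nonterminal .leftEqual => {w | ∃ n, w = List.replicate n a ++ List.replicate n b}
  | .nonterminal .rightEqual => {w | ∃ n, w = List.replicate n b ++ List.replicate n c}
  | .nonterminal .first => {w | ∃ n, w = List.replicate n a}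
  | .nonterminal .last => {w | ∃ n, w = List.replicate n c}

lemma cons_replicate_append_append_singleton (s t : T) (n : ℕ) :
    [s] ++ (List.replicate n s ++ List.replicate n t ++ [t]) =
      List.replicate (n + 1) s ++ List.replicate (n + 1) t := by
  rw [List.append_assoc, ← List.replicate_succ', ← List.append_assoc]
  rfl

lemma prod_someEqualSymbolLanguage_le {r : ContextFreeRule T SomeEqualNT}
    (hr : r ∈ someEqualRules a b c) :
    (r.output.map (someEqualSymbolLanguage a b c)).prod ≤
      someEqualSymbolLanguage a b c (.nonterminal r.input) := by
  simp only [someEqualRules, List.mem_cons, List.not_mem_nil, or_false] at hr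
  rcases hr with rfl | rfl | rfl | rfl | rfl | rfl | rfl | rfl | rfl | rfl <;> intro w hw
  · obtain ⟨_, ⟨n, rfl⟩, _, ⟨_, ⟨l, rfl⟩, _, rfl, rfl⟩, rfl⟩ := hw
    exact ⟨n, n, l, .inl rfl, by simp⟩
  · obtain ⟨_, ⟨n, rfl⟩, _, ⟨_, ⟨l, rfl⟩, _, rfl, rfl⟩, rfl⟩ := hw
    exact ⟨n, l, l, .inr rfl, by simp⟩
  · obtain ⟨_, rfl, _, ⟨_, ⟨n, rfl⟩, _, ⟨_, rfl, _, rfl, rfl⟩, rfl⟩, rfl⟩ := hw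
    exact ⟨n + 1, cons_replicate_append_append_singleton a b n⟩
  · exact ⟨0, hw⟩
  · obtain ⟨_, rfl, _, ⟨_, ⟨n, rfl⟩, _, ⟨_, rfl, _, rfl, rfl⟩, rfl⟩, rfl⟩ := hw
    exact ⟨n + 1, cons_replicate_append_append_singleton b c n⟩
  · exact ⟨0, hw⟩
  · obtain ⟨_, rfl, _, ⟨_, ⟨n, rfl⟩, _, rfl, rfl⟩, rfl⟩ := hw
    exact ⟨n + 1, by simp [List.replicate_succ]⟩
  · exact ⟨0, hw⟩
  · obtain ⟨_, rfl, _, ⟨_, ⟨n, rfl⟩, _, rfl, rfl⟩, rfl⟩ := hw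
    exact ⟨n + 1, by simp [List.replicate_succ]⟩
  · exact ⟨0, hw⟩

end SomeEqual

section Replicate

variable {T : Type*} {g : ContextFreeGrammar T} {A : g.NT} {s t : T}

lemma nil_mem_yieldLanguage (h : ⟨A, []⟩ ∈ g.rules) : [] ∈ yieldLanguage g (.nonterminal A) :=
  prod_yieldLanguage_le h Language.nil_mem_one

lemma append_mem_yieldLanguage {X Y : Symbol T g.NT} (h : ⟨A, [X, Y]⟩ ∈ g.rules) {u v : List T}
    (hu : u ∈ yieldLanguage g X) (hv : v ∈ yieldLanguage g Y) :
    u ++ v ∈ yieldLanguage g (.nonterminal A) := by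
  refine prod_yieldLanguage_le h ?_
  simp only [List.map_cons, List.map_nil, List.prod_cons, List.prod_nil, mul_one]
  exact Language.append_mem_mul hu hv

lemma replicate_mem_yieldLanguage (hnil : ⟨A, []⟩ ∈ g.rules)
    (hcons : ⟨A, [.terminal t, .nonterminal A]⟩ ∈ g.rules) (n : ℕ) :
    List.replicate n t ∈ yieldLanguage g (.nonterminal A) := by
  induction n with
  | zero => exact nil_mem_yieldLanguage hnil
  | succ n ih => exact append_mem_yieldLanguage hcons (singleton_mem_yieldLanguage g t) ih

lemma replicate_append_replicate_mem_yieldLanguage (hnil : ⟨A, []⟩ ∈ g.rules)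
    (hstep : ⟨A, [.terminal s, .nonterminal A, .terminal t]⟩ ∈ g.rules) (n : ℕ) :
    List.replicate n s ++ List.replicate n t ∈ yieldLanguage g (.nonterminal A) := by
  induction n with
  | zero => exact nil_mem_yieldLanguage hnil
  | succ n ih =>
    refine prod_yieldLanguage_le hstep ?_
    rw [← cons_replicate_append_append_singleton]
    simp only [List.map_cons, List.map_nil, List.prod_cons, List.prod_nil, mul_one]
    rw [← mul_assoc, ← List.append_assoc]
    exact Language.append_mem_mul
      (Language.append_mem_mul (singleton_mem_yieldLanguage g s) ih)
      (singleton_mem_yieldLanguage g t)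

end Replicate

lemma mem_rules_someEqualGrammar {T : Type*} {a b c : T} {r : ContextFreeRule T SomeEqualNT} :
    r ∈ (someEqualGrammar a b c).rules ↔ r ∈ someEqualRules a b c := by
  classical exact List.mem_toFinset

lemma someEqualLanguage_le_yieldLanguage {T : Type*} (a b c : T) :
    someEqualLanguage a b c ≤ yieldLanguage (someEqualGrammar a b c) (.nonterminal .start) := by
  have hrules {r} (hr : r ∈ someEqualRules a b c) : r ∈ (someEqualGrammar a b c).rules :=
    mem_rules_someEqualGrammar.2 hr
  have hfirst := replicate_mem_yieldLanguage (g := someEqualGrammar a b c) (A := .first) (t := a)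
    (hrules (by repeat constructor)) (hrules (by repeat constructor))
  have hlast := replicate_mem_yieldLanguage (g := someEqualGrammar a b c) (A := .last) (t := c)
    (hrules (by repeat constructor)) (hrules (by repeat constructor))
  have hleft := replicate_append_replicate_mem_yieldLanguage (g := someEqualGrammar a b c)
    (A := .leftEqual) (s := a) (t := b)
    (hrules (by repeat constructor)) (hrules (by repeat constructor))
  have hright := replicate_append_replicate_mem_yieldLanguage (g := someEqualGrammar a b c)
    (A := .rightEqual) (s := b) (t := c)
    (hrules (by repeat constructor)) (hrules (by repeat constructor))
  rintro _ ⟨n, m, l, rfl | rfl, rfl⟩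
  · exact append_mem_yieldLanguage (hrules (List.mem_cons_self ..)) (hleft n) (hlast l)
  · rw [List.append_assoc]
    exact append_mem_yieldLanguage (hrules (List.mem_cons_of_mem _ (List.mem_cons_self ..)))
      (hfirst n) (hright m)

theorem language_someEqualGrammar {T : Type*} (a b c : T) :
    (someEqualGrammar a b c).language = someEqualLanguage a b c := by
  rw [language_eq_yieldLanguage]
  exact le_antisymm (yieldLanguage_le (g := someEqualGrammar a b c)
      (L := someEqualSymbolLanguage a b c) (fun _ => rfl)
      (fun _ hr => prod_someEqualSymbolLanguage_le (mem_rules_someEqualGrammar.1 hr)) _)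
    (someEqualLanguage_le_yieldLanguage a b c)

end TreeSeries

theorem mainTheorem6 {T : Type*} (a b c : T) (hab : a ≠ b) (hac : a ≠ c) (hbc : b ≠ c) :
    (¬ ∃ G : GF2Grammar T, G.language = someEqualLanguage a b c) ∧
      (someEqualLanguage a b c).IsInherentlyAmbiguous := by
  have hne : ¬ ∃ G : GF2Grammar T, G.language = someEqualLanguage a b c := fun ⟨G, hG⟩ =>
    TreeSeries.gf2Grammar_language_ne_someEqualLanguage hab hac hbc G hG
  refine ⟨hne, ⟨_, TreeSeries.language_someEqualGrammar a b c⟩, fun g hg hunambiguous => hne ?_⟩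
  obtain ⟨G, hG⟩ := TreeSeries.exists_gf2Grammar_of_isUnambiguous hunambiguous
  exact ⟨G, hG.trans hg⟩
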